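/- Let $s\in\tfrac12\mathbb Z_{\ge 0}$ and let $\mathcal H_s$ be the $(2s+1)$-dimensional space of spin-$s$ states, with orthonormal basis $|s,j\rangle$ and spin operators $\mathbf S=(S_x,S_y,S_z)$. A state $\psi$ is anticoherent of order $t$ if $\langle\psi|(\hat n\cdot \mathbf S)^k|\psi\rangle$ is independent of the unit vector $\hat n\in\mathbb R^3$ for every $k\le t$; a subspace is $t$-anticoherent if each of its unit vectors is anticoherent of some order $r\ge t$. The Majorana polynomial of $\psi=\sum_j a_j|s,j\rangle$ is $M_\psi(z,w)=\sum_{j=-s}^{s}(-1)^{j-s}a_j\binom{2s}{s+j}^{1/2}z^{s+j}w^{s-j}$. **(1)** Let $G\subset SU(2)$ be a binary dihedral group of order $4n$ ($n\ge 2$), a binary tetrahedral, a binary octahedral or a binary icosahedral group (in any position, i.e. any conjugate in $SU(2)$ of the standard one), and put $t=1,2,3,5$ respectively. Let $h_1,h_2,h_3\in\mathbb C[z,w]$ be homogeneous $G$-invariant polynomials of degrees $d_1,d_2,d_3$ (for instance Klein's absolute invariants of $G$). Then for every $s$ the products $h_1^uh_2^vh_3^w$ with nonnegative integers $u,v,w$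 satisfying $ud_1+vd_2+wd_3=2s$ are Majorana polynomials of spin-$s$ states, and the states so obtained span a $t$-anticoherent subspace of $\mathcal H_s$. Here the standard groups are generated as follows, with $\Delta(x)=\mathrm{diag}(e^{ix},e^{-ix})$, $J=\begin{pmatrix}0&1\\-1&0\end{pmatrix}$, $R=\tfrac12\begin{pmatrix}1+i&1+i\\-1+i&1-i\end{pmatrix}$, $\varepsilon=e^{2\pi i/5}$ and $Q=\tfrac1{\sqrt5}\begin{pmatrix}-(\varepsilon-\varepsilon^4)&\varepsilon^2-\varepsilon^3\\ \varepsilon^2-\varepsilon^3&\varepsilon-\varepsilon^4\end{pmatrix}$: binary dihedral of order $4n$ by $\Delta(\pi/n),J$; binary tetrahedral by $\Delta(\pi/2),J,R$; binary octahedral by $\Delta(\pi/4),J,R$; binary icosahedral by $\Delta(6\pi/5),J,Q$. They act by $(g\cdot p)(z,w)=p(g(z,w))$. **(2)** For the groups in standard position one can take the following homogeneous invariants: - binary dihedral of order $4n$, $n\ge2$, degrees $(4,2n,2n+2)$: $h_1=z^2w^2$, $h_2=z^{2n}-(1+(-1)^n)z^nw^n+w^{2n}$, $h_3=z^{2n+1}w-zw^{2n+1}$;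 - binary tetrahedral, degrees $(6,8,12)$: $h_1=z^5w-zw^5$, $h_2=z^8+14z^4w^4+w^8$, $h_3=z^{12}-33z^8w^4-33z^4w^8+w^{12}$; - binary octahedral, degrees $(8,12,18)$: with $f=z^5w-zw^5$, $h_1=z^8+14z^4w^4+w^8$, $h_2=f^2$, $h_3=f\,(z^{12}-33z^8w^4-33z^4w^8+w^{12})$; - binary icosahedral, degrees $(12,20,30)$: $h_1=z^{11}w+11z^6w^6-zw^{11}$, $h_2=-(z^{20}+w^{20})+228(z^{15}w^5-z^5w^{15})-494z^{10}w^{10}$, $h_3=z^{30}+w^{30}+522(z^{25}w^5-z^5w^{25})-10005(z^{20}w^{10}+z^{10}w^{20})$. With these invariants the spin-$s$ subspace of (1) is $t$-anticoherent, its dimension is at most the (finite) number of solutions $(u,v,w)$, and the products belonging to any two distinct solutions for the same $s$ are linearly independent. **(3)** Consequently, with the subspaces of (2): - the binary dihedral group of order $8$ gives a $1$-anticoherent subspace of dimension at least two for every integer $s\ge2$, $s\ne3$; - the binary tetrahedral group gives a $2$-anticoherent subspace of dimension at least two for $s=6$ and every even integer $s\ge10$; - the binary octahedral group gives a $3$-anticoherent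 subspace of dimension at least two for $s=12,16,18,20,21,22$ and every integer $s\ge24$; - the binary icosahedral group gives a $5$-anticoherent subspace of dimension exactly two for $s=30$ and for some $s>30$, and of dimension at least two for every $s=30+6a+10b+15c$ with integers $a,b,c\ge0$. **(4)** For $s=6$ there are unique states $\psi_1,\psi_2$ with Majorana polynomials $h_1^2=z^{10}w^2-2z^6w^6+z^2w^{10}$ and $h_3=z^{12}-33z^8w^4-33z^4w^8+w^{12}$ ($h_1,h_3$ of the binary tetrahedral group); they span the subspace given by that group for $s=6$, which is two-dimensional and $2$-anticoherent. -/

import Mathlib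

open MvPolynomial

namespace Spin

noncomputable section

/-! ## Spin-`s` states, `s = N / 2` -/

/-- The Hilbert space of spin-`N/2` states. The standard basis vector with index `m : Fin (N + 1)`
is `|s, j⟩` with `s = N / 2` and `j = m - s`. -/
abbrev State (N : ℕ) : Type := EuclideanSpace ℂ (Fin (N + 1))

/-- `S_z |s, j⟩ = j |s, j⟩`, in units with `ħ = 1`. -/
def Sz (N : ℕ) : Matrix (Fin (N + 1)) (Fin (N + 1)) ℂ :=
  Matrix.diagonal fun m => (m.val : ℂ) - (N : ℂ) / 2

/-- The raising operator `S_+ |s, j⟩ = √((s - j) (s + j + 1)) |s, j + 1⟩`. -/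
def Splus (N : ℕ) : Matrix (Fin (N + 1)) (Fin (N + 1)) ℂ :=
  Matrix.of fun i m =>
    if i.val = m.val + 1 then ((Real.sqrt (((N : ℝ) - m.val) * (m.val + 1)) : ℝ) : ℂ) else 0

/-- The lowering operator `S_-`, the adjoint of `S_+`. -/
def Sminus (N : ℕ) : Matrix (Fin (N + 1)) (Fin (N + 1)) ℂ := (Splus N).conjTranspose

def Sx (N : ℕ) : Matrix (Fin (N + 1)) (Fin (N + 1)) ℂ := (1 / 2 : ℂ) • (Splus N + Sminus N)

def Sy (N : ℕ) : Matrix (Fin (N + 1)) (Fin (N + 1)) ℂ :=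
  (1 / (2 * Complex.I)) • (Splus N - Sminus N)

/-- The observable `n · S` of spin along the axis `n`. -/
def spinAlong (N : ℕ) (n : EuclideanSpace ℝ (Fin 3)) : Matrix (Fin (N + 1)) (Fin (N + 1)) ℂ :=
  (n 0 : ℂ) • Sx N + (n 1 : ℂ) • Sy N + (n 2 : ℂ) • Sz N

/-- The expected value `⟨A⟩ = ⟨ψ | A | ψ⟩`. -/
def expectation {N : ℕ} (ψ : State N) (A : Matrix (Fin (N + 1)) (Fin (N + 1)) ℂ) : ℂ :=
  inner ℂ ψ (Matrix.toEuclideanLin A ψ)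

/-- `⟨(n · S)^k⟩` does not depend on the unit vector `n`, for every `k ≤ t`. -/
def IsAnticoherent {N : ℕ} (t : ℕ) (ψ : State N) : Prop :=
  ∀ k ≤ t, ∃ c : ℂ, ∀ n : EuclideanSpace ℝ (Fin 3), ‖n‖ = 1 →
    expectation ψ (spinAlong N n ^ k) = c

/-- Every unit vector of `V` is anticoherent of some order `r ≥ t`. -/
def IsAnticoherentSubspace {N : ℕ} (t : ℕ) (V : Submodule ℂ (State N)) : Prop :=
  ∀ ψ ∈ V, ‖ψ‖ = 1 → ∃ r, t ≤ r ∧ IsAnticoherent r ψ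

/-! ## Majorana polynomials. The variables are `z = X 0` and `w = X 1`. -/

abbrev BinaryForm : Type := MvPolynomial (Fin 2) ℂ

/-- The homogeneous Majorana polynomial
`∑_j (-1)^(j - s) a_j (2s choose s + j)^(1/2) z^(s + j) w^(s - j)` of `∑_j a_j |s, j⟩`,
with `N = 2 s` and `m = s + j`. -/
def majorana (N : ℕ) : State N →ₗ[ℂ] BinaryForm where
  toFun ψ := ∑ m : Fin (N + 1),
    C ((-1) ^ (N - m.val) * ψ m * ((Real.sqrt (N.choose m.val : ℝ) : ℝ) : ℂ)) *
      (X 0 ^ m.val * X 1 ^ (N - m.val))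
  map_add' ψ φ := by
    rw [← Finset.sum_add_distrib]
    refine Finset.sum_congr rfl fun m _ => ?_
    rw [← add_mul, ← C_add]
    congr 2
    simp only [PiLp.add_apply]
    ring
  map_smul' a ψ := by
    rw [RingHom.id_apply, Finset.smul_sum]
    refine Finset.sum_congr rfl fun m _ => ?_
    rw [smul_eq_C_mul, ← mul_assoc (C a), ← C_mul]
    congr 2
    simp only [PiLp.smul_apply, smul_eq_mul]
    ring

/-- The spin-`N/2` states whose Majorana polynomial lies in `P`. -/
def statesOf (N : ℕ) (P : Submodule ℂ BinaryForm) : Submodule ℂ (State N) :=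
  P.comap (majorana N)

/-! ## Invariants of subgroups of `SU(2)` -/

/-- The group `SU(2)`. -/
abbrev SU2 : Type := Matrix.specialUnitaryGroup (Fin 2) ℂ

/-- The linear substitution `(z, w) ↦ g (z, w)` in a form. -/
def substitute (g : SU2) (p : BinaryForm) : BinaryForm :=
  aeval (fun i : Fin 2 => ∑ j : Fin 2, C (g.val i j) * X j) p

def IsInvariant (G : Subgroup SU2) (p : BinaryForm) : Prop :=
  ∀ g ∈ G, substitute g p = p

/-- The solutions `(u, v, w)` of `u d₁ + v d₂ + w d₃ = N` in nonnegative integers. -/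
def solutions (d : Fin 3 → ℕ) (N : ℕ) : Set (ℕ × ℕ × ℕ) :=
  {e | e.1 * d 0 + e.2.1 * d 1 + e.2.2 * d 2 = N}

/-- `h₁^u h₂^v h₃^w`. -/
def monomialIn (h : Fin 3 → BinaryForm) (e : ℕ × ℕ × ℕ) : BinaryForm :=
  h 0 ^ e.1 * h 1 ^ e.2.1 * h 2 ^ e.2.2

/-- The span of the products `h₁^u h₂^v h₃^w` of total degree `N`, where `h_i` has degree `d i`. -/
def productSpan (h : Fin 3 → BinaryForm) (d : Fin 3 → ℕ) (N : ℕ) : Submodule ℂ BinaryForm :=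
  Submodule.span ℂ (monomialIn h '' solutions d N)

/-! ## The binary polyhedral groups -/

/-- The element `!![a, b; -b̄, ā]` of `SU(2)`. -/
def su2 (a b : ℂ) (hab : a * star a + b * star b = 1) : SU2 :=
  ⟨!![a, b; -star b, star a], by
    rw [Matrix.mem_specialUnitaryGroup_iff, Matrix.mem_unitaryGroup_iff]
    constructor
    · ext i j
      fin_cases i <;> fin_cases j <;>
        simp [Matrix.mul_apply, Fin.sum_univ_two, Matrix.star_apply] <;>
        simp at hab <;> first | linear_combination hab | ring
    · rw [Matrix.det_fin_two_of]
      linear_combination hab⟩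

theorem exp_mul_star (x : ℝ) :
    Complex.exp (x * Complex.I) * star (Complex.exp (x * Complex.I)) + (0 : ℂ) * star (0 : ℂ)
      = 1 := by
  have h : star (Complex.exp (x * Complex.I)) = Complex.exp (-(x * Complex.I)) := by
    rw [Complex.star_def, ← Complex.exp_conj]
    simp
  rw [h, ← Complex.exp_add]
  simp

/-- The matrix `diag (e^(i x), e^(-i x))`. -/
def diagRot (x : ℝ) : SU2 := su2 (Complex.exp (x * Complex.I)) 0 (exp_mul_star x)

/-- The matrix `!![0, 1; -1, 0]`. -/
def swapJ : SU2 := su2 0 1 (by simp)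

/-- The matrix `(1/2) !![1 + i, 1 + i; -1 + i, 1 - i]`, of order six. -/
def rotThree : SU2 := su2 ((1 + Complex.I) / 2) ((1 + Complex.I) / 2) (by
  simp only [Complex.star_def, map_div₀, map_add, map_one, Complex.conj_I, map_ofNat]
  linear_combination (-1 / 2 : ℂ) * Complex.I_mul_I)

/-- The matrix `(1/√5) !![-(ε - ε⁴), ε² - ε³; ε² - ε³, ε - ε⁴]` with `ε = e^(2πi/5)`, written with
`ε - ε⁴ = 2 i sin (2π/5)` and `ε² - ε³ = 2 i sin (π/5)`. -/
def icosaRot : SU2 :=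
  su2 (-((2 * Real.sin (2 * Real.pi / 5) / Real.sqrt 5 : ℝ) : ℂ) * Complex.I)
    (((2 * Real.sin (Real.pi / 5) / Real.sqrt 5 : ℝ) : ℂ) * Complex.I) (by
  have key : (2 * Real.sin (2 * Real.pi / 5) / Real.sqrt 5) ^ 2
      + (2 * Real.sin (Real.pi / 5) / Real.sqrt 5) ^ 2 = 1 := by
    have h5 : Real.sqrt 5 ^ 2 = 5 := Real.sq_sqrt (by norm_num)
    have hc : Real.cos (Real.pi / 5) = (1 + Real.sqrt 5) / 4 := Real.cos_pi_div_five
    have hs : Real.sin (Real.pi / 5) ^ 2 = 1 - ((1 + Real.sqrt 5) / 4) ^ 2 := by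
      rw [← hc]; linarith [Real.sin_sq_add_cos_sq (Real.pi / 5)]
    have h2 : Real.sin (2 * Real.pi / 5)
        = 2 * Real.sin (Real.pi / 5) * Real.cos (Real.pi / 5) := by
      rw [← Real.sin_two_mul]; congr 1; ring
    rw [div_pow, div_pow, mul_pow, mul_pow, h2, mul_pow, mul_pow, hs, hc, h5]
    have h4 : Real.sqrt 5 ^ 4 = 25 := by
      calc Real.sqrt 5 ^ 4 = (Real.sqrt 5 ^ 2) ^ 2 := by ring
        _ = 25 := by rw [h5]; norm_num
    have h3 : Real.sqrt 5 ^ 3 = 5 * Real.sqrt 5 := by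
      calc Real.sqrt 5 ^ 3 = Real.sqrt 5 ^ 2 * Real.sqrt 5 := by ring
        _ = _ := by rw [h5]
    ring_nf
    rw [h4, h3, h5]
    ring
  have key' := congrArg (fun x : ℝ => (x : ℂ)) key
  simp only [Complex.ofReal_add, Complex.ofReal_pow, Complex.ofReal_one] at key'
  simp only [Complex.star_def, map_mul, map_neg, Complex.conj_I, Complex.conj_ofReal]
  linear_combination key' -
    ((((2 * Real.sin (2 * Real.pi / 5) / Real.sqrt 5 : ℝ) : ℂ)) ^ 2
      + (((2 * Real.sin (Real.pi / 5) / Real.sqrt 5 : ℝ) : ℂ)) ^ 2) * Complex.I_mul_I)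

/-- The non-cyclic finite subgroups of `SU(2)` up to conjugacy. `dihedral n` is the binary dihedral
group of order `4 n`; for `n = 1` that group is cyclic, hence `2 ≤ n`. -/
inductive PolyhedralType where
  | dihedral (n : ℕ) (hn : 2 ≤ n)
  | tetrahedral
  | octahedral
  | icosahedral

namespace PolyhedralType

/-- The binary polyhedral group in its standard position. -/
def group : PolyhedralType → Subgroup SU2
  | dihedral n _ => Subgroup.closure {diagRot (Real.pi / n), swapJ}
  | tetrahedral => Subgroup.closure {diagRot (Real.pi / 2), swapJ, rotThree}
  | octahedral => Subgroup.closure {diagRot (Real.pi / 4), swapJ, rotThree}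
  | icosahedral => Subgroup.closure {diagRot (6 * Real.pi / 5), swapJ, icosaRot}

/-- The order of anticoherence in the table. -/
def order : PolyhedralType → ℕ
  | dihedral _ _ => 1
  | tetrahedral => 2
  | octahedral => 3
  | icosahedral => 5

/-- The degrees of Klein's invariants `h₁, h₂, h₃`. -/
def degrees : PolyhedralType → Fin 3 → ℕ
  | dihedral n _ => ![4, 2 * n, 2 * n + 2]
  | tetrahedral => ![6, 8, 12]
  | octahedral => ![8, 12, 18]
  | icosahedral => ![12, 20, 30]

/-- Klein's absolute invariants `h₁, h₂, h₃`. In the dihedral case the middle coefficient of `h₂`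
is `-2` for even `n` and `0` for odd `n`. -/
def invariants : PolyhedralType → Fin 3 → BinaryForm
  | dihedral n _ =>
      ![X 0 ^ 2 * X 1 ^ 2,
        X 0 ^ (2 * n) - C (1 + (-1) ^ n) * (X 0 ^ n * X 1 ^ n) + X 1 ^ (2 * n),
        X 0 ^ (2 * n + 1) * X 1 - X 0 * X 1 ^ (2 * n + 1)]
  | tetrahedral =>
      ![X 0 ^ 5 * X 1 - X 0 * X 1 ^ 5,
        X 0 ^ 8 + 14 * X 0 ^ 4 * X 1 ^ 4 + X 1 ^ 8,
        X 0 ^ 12 - 33 * X 0 ^ 8 * X 1 ^ 4 - 33 * X 0 ^ 4 * X 1 ^ 8 + X 1 ^ 12]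
  | octahedral =>
      ![X 0 ^ 8 + 14 * X 0 ^ 4 * X 1 ^ 4 + X 1 ^ 8,
        (X 0 ^ 5 * X 1 - X 0 * X 1 ^ 5) ^ 2,
        (X 0 ^ 5 * X 1 - X 0 * X 1 ^ 5) *
          (X 0 ^ 12 - 33 * X 0 ^ 8 * X 1 ^ 4 - 33 * X 0 ^ 4 * X 1 ^ 8 + X 1 ^ 12)]
  | icosahedral =>
      ![X 0 ^ 11 * X 1 + 11 * X 0 ^ 6 * X 1 ^ 6 - X 0 * X 1 ^ 11,
        -(X 0 ^ 20 + X 1 ^ 20) + 228 * (X 0 ^ 15 * X 1 ^ 5 - X 0 ^ 5 * X 1 ^ 15)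
          - 494 * X 0 ^ 10 * X 1 ^ 10,
        X 0 ^ 30 + X 1 ^ 30 + 522 * (X 0 ^ 25 * X 1 ^ 5 - X 0 ^ 5 * X 1 ^ 25)
          - 10005 * (X 0 ^ 20 * X 1 ^ 10 + X 0 ^ 10 * X 1 ^ 20)]

/-- `G` is a binary polyhedral group of type `T`: it is conjugate in `SU(2)` to the standard one. -/
def IsOfType (T : PolyhedralType) (G : Subgroup SU2) : Prop :=
  ∃ g : SU2, G = T.group.map (MulAut.conj g).toMonoidHom

/-- The spin-`N/2` states whose Majorana polynomial is a linear combination of products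
`h₁^u h₂^v h₃^w` of degree `N` of Klein's invariants. -/
def subspace (T : PolyhedralType) (N : ℕ) : Submodule ℂ (State N) :=
  statesOf N (productSpan T.invariants T.degrees N)

end PolyhedralType

end

end Spin

/-!
# Anticoherent subspaces from invariants of the binary polyhedral groups

A spin-`N/2` state is identified with its Majorana polynomial, a binary form of degree `N`. Under
this identification the observable `n · S` becomes a linear vector field `lieDer A` on forms, with
`A` traceless and `det A = -1/4` for a unit vector `n` (`majorana_spinAlong`), and the inner product
becomes the apolar pairing `p(∂) q |₀` (`apolar_majorana`). Multiplication by a variable is adjoint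
to differentiation for that pairing, so the chain rule makes it invariant under unitary
substitutions (`apolar_linSub`).

If the form `p` of a state is fixed by `g`, the moment `A ↦ ⟨p, (lieDer A)^k p⟩`, which is a
homogeneous polynomial function of degree `k` on traceless matrices, is therefore unchanged when `A`
is conjugated by `g` (`moment_conj`). In the coordinates `A = !![x, y; v, -x]` a rotation of order
`n` about the polar axis leaves only the monomials `x^a y^b v^e` with `b ≡ e` modulo `n`
(`exists_coeff_of_rotation_invariant`). For `k` up to the order in the table the few that remain are
handled by the other generators of the group, and only multiples of powers of
`x^2 + y v = -det A` survive (`IsConjInvariant.isotropic`). A moment is then the same for all unit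
vectors `n`, which is anticoherence. Conjugating the group amounts to conjugating the argument `A`.

Products of invariants are invariant, so all of this applies to Klein's forms. For these it suffices
to check the generators on the vertex form of the octahedron or the icosahedron, because the other
forms are its Hessian and the Jacobian of the two (`hessian_linSub`, `jacobian_linSub`). Two
products with different exponents are independent because the zeros of the three forms are
sufficiently different (`linearIndependent_monomialIn`). The dimensions follow by exhibiting two
solutions of the degree equation; in the icosahedral case the syzygy `T² + H³ = 1728 f⁵` bounds the
dimension from above.
-/

namespace Spin

noncomputable section

/-! ### Linear substitutions and linear vector fields on binary forms -/

/-- The algebra endomorphism `X i ↦ ∑ j, A i j * X j` of binary forms. -/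
def linSub (A : Matrix (Fin 2) (Fin 2) ℂ) : BinaryForm →ₐ[ℂ] BinaryForm :=
  aeval fun i => ∑ j, C (A i j) * X j

/-- The derivation `X i ↦ ∑ j, A i j * X j` of binary forms, the infinitesimal version of
`linSub`. -/
def lieDer (A : Matrix (Fin 2) (Fin 2) ℂ) : Derivation ℂ BinaryForm BinaryForm :=
  mkDerivation ℂ fun i => ∑ j, C (A i j) * X j

theorem substitute_eq_linSub (g : SU2) (p : BinaryForm) : substitute g p = linSub g.val p := rfl

theorem linSub_X (A : Matrix (Fin 2) (Fin 2) ℂ) (i : Fin 2) :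
    linSub A (X i) = ∑ j, C (A i j) * X j := by
  simp [linSub]

theorem linSub_C (A : Matrix (Fin 2) (Fin 2) ℂ) (c : ℂ) : linSub A (C c) = C c := by
  simp [linSub, algebraMap_eq]

theorem lieDer_X (A : Matrix (Fin 2) (Fin 2) ℂ) (i : Fin 2) :
    lieDer A (X i) = ∑ j, C (A i j) * X j := by
  simp [lieDer, mkDerivation_X]

theorem linSub_one (p : BinaryForm) : linSub 1 p = p := by
  have : linSub 1 = AlgHom.id ℂ BinaryForm := by
    ext i : 1
    fin_cases i <;> simp [linSub_X, Fin.sum_univ_two]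
  rw [this, AlgHom.id_apply]

/-- Substitution is a right action of matrices. -/
theorem linSub_mul (A B : Matrix (Fin 2) (Fin 2) ℂ) (p : BinaryForm) :
    linSub (A * B) p = linSub B (linSub A p) := by
  have : linSub (A * B) = (linSub B).comp (linSub A) := by
    ext i : 1
    simp only [AlgHom.comp_apply, linSub_X, Fin.sum_univ_two, map_add, map_mul, linSub_C,
      Matrix.mul_apply]
    ring
  rw [this, AlgHom.comp_apply]

theorem lieDer_add (A B : Matrix (Fin 2) (Fin 2) ℂ) : lieDer (A + B) = lieDer A + lieDer B := by
  refine derivation_ext fun i => ?_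
  simp only [Derivation.add_apply, lieDer_X, Fin.sum_univ_two, Matrix.add_apply, C_add]
  ring

theorem lieDer_smul (c : ℂ) (A : Matrix (Fin 2) (Fin 2) ℂ) : lieDer (c • A) = c • lieDer A := by
  refine derivation_ext fun i => ?_
  simp only [Derivation.smul_apply, lieDer_X, Fin.sum_univ_two, Matrix.smul_apply, smul_eq_C_mul,
    smul_eq_mul, C_mul]
  ring

/-- The chain rule for a linear substitution. -/
theorem pderiv_linSub (A : Matrix (Fin 2) (Fin 2) ℂ) (j : Fin 2) (p : BinaryForm) :
    pderiv j (linSub A p) = ∑ k, C (A k j) * linSub A (pderiv k p) := by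
  induction p using MvPolynomial.induction_on with
  | C a => simp
  | add p q hp hq =>
    simp only [map_add, hp, hq, Fin.sum_univ_two]
    ring
  | mul_X p i hp =>
    rw [map_mul, pderiv_mul, hp, linSub_X]
    fin_cases i <;> fin_cases j <;>
      simp [Fin.sum_univ_two, pderiv_X, linSub_X, Pi.single_apply] <;> ring

/-- Conjugating the vector field of `A` by the substitution `B` gives the vector field of
`B⁻¹ * A * B`. -/
theorem lieDer_linSub {A A' B : Matrix (Fin 2) (Fin 2) ℂ} (h : B * A' = A * B) (p : BinaryForm) :
    lieDer A' (linSub B p) = linSub B (lieDer A p) := by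
  have h' : ∀ i j, ∑ k, B i k * A' k j = ∑ k, A i k * B k j := fun i j => by
    rw [← Matrix.mul_apply, ← Matrix.mul_apply, h]
  induction p using MvPolynomial.induction_on with
  | C a =>
    rw [linSub_C, ← algebraMap_eq, Derivation.map_algebraMap, Derivation.map_algebraMap, map_zero]
  | add p q hp hq => simp only [map_add, hp, hq]
  | mul_X p i hp =>
    simp only [map_mul, Derivation.leibniz, smul_eq_mul, map_add, hp]
    congr 2
    simp only [linSub_X, lieDer_X, map_sum, Derivation.leibniz, smul_eq_mul, map_mul, linSub_C]
    have hC : ∀ (B : Matrix (Fin 2) (Fin 2) ℂ) (c : ℂ), lieDer B (C c) = 0 := fun B c => by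
      rw [← algebraMap_eq, Derivation.map_algebraMap]
    simp only [hC, Fin.sum_univ_two, mul_zero, add_zero]
    have e0 := congrArg (C : ℂ → BinaryForm) (h' i 0)
    have e1 := congrArg (C : ℂ → BinaryForm) (h' i 1)
    simp only [Fin.sum_univ_two, C_add, C_mul] at e0 e1
    linear_combination X 0 * e0 + X 1 * e1

theorem lieDer_iterate_linSub {A A' B : Matrix (Fin 2) (Fin 2) ℂ} (h : B * A' = A * B) (k : ℕ)
    (p : BinaryForm) : (lieDer A')^[k] (linSub B p) = linSub B ((lieDer A)^[k] p) := by
  induction k generalizing p with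
  | zero => rfl
  | succ k ih => rw [Function.iterate_succ_apply, lieDer_linSub h, ih, Function.iterate_succ_apply]

/-! ### The apolar pairing and its invariance under unitary substitutions -/

/-- The apolar pairing `⟨p, q⟩ = p(∂) q |₀` on binary forms: it is bilinear, and the monomials are
orthogonal with `⟨z^a w^b, z^a w^b⟩ = a! b!`. -/
def apolar : BinaryForm →ₗ[ℂ] BinaryForm →ₗ[ℂ] ℂ :=
  (basisMonomials (Fin 2) ℂ).constr ℂ fun d =>
    (((d 0).factorial * (d 1).factorial : ℕ) : ℂ) • lcoeff ℂ d

theorem apolar_monomial (d : Fin 2 →₀ ℕ) (q : BinaryForm) :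
    apolar (monomial d 1) q = ((d 0).factorial * (d 1).factorial : ℕ) * coeff d q := by
  have : (monomial d (1 : ℂ) : BinaryForm) = basisMonomials (Fin 2) ℂ d := by simp
  rw [this, apolar, Module.Basis.constr_basis]
  simp [lcoeff]

theorem apolar_C (c : ℂ) (q : BinaryForm) : apolar (C c) q = c * coeff 0 q := by
  have : (C c : BinaryForm) = c • monomial 0 1 := by rw [smul_monomial]; simp
  rw [this, map_smul, LinearMap.smul_apply, apolar_monomial]
  simp

/-- Multiplication by a variable is adjoint to differentiation. -/
theorem apolar_X_mul (i : Fin 2) (p q : BinaryForm) :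
    apolar (X i * p) q = apolar p (pderiv i q) := by
  induction p using MvPolynomial.induction_on' with
  | add p q hp hq => simp only [mul_add, map_add, LinearMap.add_apply, hp, hq]
  | monomial d a =>
    have ha : (monomial d a : BinaryForm) = a • monomial d 1 := by rw [smul_monomial]; simp
    have hX : (X i * monomial d 1 : BinaryForm) = monomial (d + Finsupp.single i 1) 1 := by
      rw [X, monomial_mul, add_comm, one_mul]
    rw [ha, mul_smul_comm, map_smul, map_smul, LinearMap.smul_apply, LinearMap.smul_apply,
      hX, apolar_monomial, apolar_monomial, coeff_pderiv]
    congr 1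
    fin_cases i <;> simp [Nat.factorial_succ] <;> ring

/-- The apolar pairing is invariant under a substitution `A` on one side and the contragredient
substitution on the other side. -/
theorem apolar_linSub {A B : Matrix (Fin 2) (Fin 2) ℂ} (h : A * B.transpose = 1)
    (p q : BinaryForm) : apolar (linSub B p) (linSub A q) = apolar p q := by
  have h' : ∀ i k, ∑ j, A i j * B k j = if i = k then 1 else 0 := fun i k => by
    rw [← Matrix.one_apply, ← h, Matrix.mul_apply]; rfl
  induction p using MvPolynomial.induction_on generalizing q with
  | C c =>
    -- Pairing with a constant reads off the constant coefficient, which no substitution changes.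
    have hq : coeff 0 (linSub A q) = coeff 0 q := by
      simp only [← constantCoeff_eq]
      induction q using MvPolynomial.induction_on with
      | C a => simp
      | add p q hp hq => simp only [map_add, hp, hq]
      | mul_X p i hp => simp [linSub_X]
    rw [linSub_C, apolar_C, apolar_C, hq]
  | add p q hp hq => simp only [map_add, LinearMap.add_apply, hp, hq]
  | mul_X p i hp =>
    have hs : ∀ c (r : BinaryForm), apolar (linSub B p) (C c * r) = c * apolar (linSub B p) r :=
      fun c r => by rw [← smul_eq_C_mul, map_smul, smul_eq_mul]
    have hl : ∀ c (r s : BinaryForm), apolar (C c * r) s = c * apolar r s :=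
      fun c r s => by rw [← smul_eq_C_mul, map_smul, LinearMap.smul_apply, smul_eq_mul]
    rw [mul_comm p, map_mul, apolar_X_mul, linSub_X, Finset.sum_mul, map_sum,
      LinearMap.sum_apply]
    simp only [mul_assoc, hl, apolar_X_mul, pderiv_linSub, map_sum, hs, hp, Finset.mul_sum]
    rw [Finset.sum_comm]
    have := fun k : Fin 2 => h' k i
    simp only [Fin.sum_univ_two] at this ⊢
    have h0 := this 0
    have h1 := this 1
    fin_cases i <;> simp at h0 h1 ⊢
    · linear_combination (apolar p (pderiv 0 q)) * h0 + (apolar p (pderiv 1 q)) * h1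
    · linear_combination (apolar p (pderiv 0 q)) * h0 + (apolar p (pderiv 1 q)) * h1

/-- Complex conjugation of the coefficients of a form. -/
abbrev conjForm (p : BinaryForm) : BinaryForm := map (starRingEnd ℂ) p

theorem conjForm_linSub (A : Matrix (Fin 2) (Fin 2) ℂ) (p : BinaryForm) :
    conjForm (linSub A p) = linSub (A.map star) (conjForm p) := by
  induction p using MvPolynomial.induction_on with
  | C a => simp
  | add p q hp hq => simp only [map_add, conjForm] at *; rw [hp, hq]
  | mul_X p i hp =>
    simp only [conjForm, map_mul, map_X, linSub_X, map_sum, map_C] at *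
    rw [hp]
    simp

/-- The moment `⟨p, (lieDer A)^k p⟩` of a form for the Hermitian apolar product: the expectation of
the `k`-th power of the observable represented by `A`, up to a constant factor. -/
def moment (p : BinaryForm) (k : ℕ) (A : Matrix (Fin 2) (Fin 2) ℂ) : ℂ :=
  apolar (conjForm p) ((lieDer A)^[k] p)

/-- The moments of a form fixed by `g` are class functions for `g`. -/
theorem moment_conj {p : BinaryForm} {g : SU2} (hp : substitute g p = p) (k : ℕ)
    (A : Matrix (Fin 2) (Fin 2) ℂ) : moment p k (g.val * A * (g⁻¹).val) = moment p k A := by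
  have hg : g.val * star g.val = 1 :=
    Matrix.mem_unitaryGroup_iff.1 (Matrix.mem_specialUnitaryGroup_iff.1 g.2).1
  have h1 : g.val * (g⁻¹).val = 1 := by
    rw [← Submonoid.coe_mul, mul_inv_cancel, Submonoid.coe_one]
  have h2 : (g⁻¹).val * g.val = 1 := by
    rw [← Submonoid.coe_mul, inv_mul_cancel, Submonoid.coe_one]
  rw [substitute_eq_linSub] at hp
  have key := lieDer_iterate_linSub (A := g.val * A * (g⁻¹).val) (A' := A) (B := g.val)
    (by rw [mul_assoc, h2, mul_one]) k p
  rw [hp] at key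
  have e : conjForm p = linSub (g.val.map star) (conjForm p) := by rw [← conjForm_linSub, hp]
  rw [moment, moment, key]
  conv_rhs => rw [e]
  refine (apolar_linSub ?_ _ _).symm
  rw [← hg]; rfl

/-! ### Spin states as binary forms -/

theorem majorana_apply (N : ℕ) (ψ : State N) :
    majorana N ψ = ∑ m : Fin (N + 1),
      C ((-1) ^ (N - m.val) * ψ m * ((Real.sqrt (N.choose m.val : ℝ) : ℝ) : ℂ)) *
        (X 0 ^ m.val * X 1 ^ (N - m.val)) := rfl

theorem majorana_single (N : ℕ) (m : Fin (N + 1)) :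
    majorana N (EuclideanSpace.single m 1) =
      C ((-1) ^ (N - m.val) * ((Real.sqrt (N.choose m.val : ℝ) : ℝ) : ℂ)) *
        (X 0 ^ m.val * X 1 ^ (N - m.val)) := by
  rw [majorana_apply, Finset.sum_eq_single m]
  · simp
  · intro b _ hb
    simp [hb]
  · simp

theorem X_pow_mul_X_pow (a b : ℕ) :
    (X 0 ^ a * X 1 ^ b : BinaryForm) = monomial (Finsupp.single 0 a + Finsupp.single 1 b) 1 := by
  rw [X_pow_eq_monomial, X_pow_eq_monomial, monomial_mul, one_mul]

theorem exponent_eq_iff (a b a' b' : ℕ) :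
    (Finsupp.single 0 a + Finsupp.single 1 b : Fin 2 →₀ ℕ)
      = Finsupp.single 0 a' + Finsupp.single 1 b' ↔ a = a' ∧ b = b' := by
  constructor
  · intro h
    have h0 := DFunLike.congr_fun h 0
    have h1 := DFunLike.congr_fun h 1
    simp at h0 h1
    exact ⟨h0, h1⟩
  · rintro ⟨rfl, rfl⟩
    rfl

theorem coeff_majorana (N : ℕ) (ψ : State N) (m : Fin (N + 1)) :
    coeff (Finsupp.single 0 m.val + Finsupp.single 1 (N - m.val)) (majorana N ψ)
      = (-1) ^ (N - m.val) * ψ m * ((Real.sqrt (N.choose m.val : ℝ) : ℝ) : ℂ) := by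
  rw [majorana_apply, coeff_sum, Finset.sum_eq_single m]
  · rw [coeff_C_mul, X_pow_mul_X_pow, coeff_monomial, if_pos rfl, mul_one]
  · intro b _ hb
    rw [coeff_C_mul, X_pow_mul_X_pow, coeff_monomial, if_neg, mul_zero]
    rw [exponent_eq_iff]
    exact fun h => hb (Fin.ext h.1)
  · simp

theorem sqrt_choose_ne_zero (N : ℕ) (m : Fin (N + 1)) :
    ((Real.sqrt (N.choose m.val : ℝ) : ℝ) : ℂ) ≠ 0 := by
  have : 0 < N.choose m.val := Nat.choose_pos (Nat.lt_succ_iff.1 m.2)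
  exact_mod_cast (Real.sqrt_pos.2 (Nat.cast_pos.2 this)).ne'

theorem majorana_injective (N : ℕ) : Function.Injective (majorana N) := by
  rw [← LinearMap.ker_eq_bot, LinearMap.ker_eq_bot']
  intro ψ hψ
  ext m
  have h := coeff_majorana N ψ m
  rw [hψ, coeff_zero, eq_comm, mul_eq_zero, mul_eq_zero] at h
  rcases h with (h | h) | h
  · exact absurd h (pow_ne_zero _ (by norm_num))
  · simpa using h
  · exact absurd h (sqrt_choose_ne_zero N m)

/-- Every binary form of degree `N` is the Majorana polynomial of a spin-`N/2` state. -/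
theorem exists_majorana_eq {N : ℕ} {p : BinaryForm} (hp : p.IsHomogeneous N) :
    ∃ ψ, majorana N ψ = p := by
  suffices h : p ∈ LinearMap.range (majorana N) from h
  rw [as_sum p]
  refine Submodule.sum_mem _ fun d hd => ?_
  have hdeg : d 0 + d 1 = N := by
    have := hp (mem_support_iff.1 hd)
    rwa [Finsupp.weight_apply, Finsupp.sum_fintype _ _ (by simp), Fin.sum_univ_two, Pi.one_apply,
      Pi.one_apply, smul_eq_mul, smul_eq_mul, mul_one, mul_one] at this
  have hm : d 0 < N + 1 := by omega
  have hd' : d = Finsupp.single 0 (d 0) + Finsupp.single 1 (N - d 0) := by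
    ext i
    fin_cases i
    · simp
    · simp; omega
  set c : ℂ := (-1) ^ (N - d 0) * ((Real.sqrt (N.choose (d 0) : ℝ) : ℝ) : ℂ) with hc
  have hc0 : c ≠ 0 := mul_ne_zero (pow_ne_zero _ (by norm_num)) (sqrt_choose_ne_zero N ⟨d 0, hm⟩)
  refine ⟨(coeff d p / c) • EuclideanSpace.single ⟨d 0, hm⟩ 1, ?_⟩
  rw [map_smul, majorana_single, X_pow_mul_X_pow]
  simp only
  rw [← hd', ← hc, C_mul_monomial, smul_monomial, smul_eq_mul, mul_one, div_mul_cancel₀ _ hc0]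

/-- The apolar pairing is, up to the factor `N!`, the inner product of spin states. -/
theorem apolar_majorana (N : ℕ) (ψ φ : State N) :
    apolar (conjForm (majorana N ψ)) (majorana N φ) = (N.factorial : ℂ) * inner ℂ ψ φ := by
  have hconj : conjForm (majorana N ψ) = ∑ m : Fin (N + 1),
      ((-1) ^ (N - m.val) * star (ψ m) * ((Real.sqrt (N.choose m.val : ℝ) : ℝ) : ℂ)) •
        monomial (Finsupp.single 0 m.val + Finsupp.single 1 (N - m.val)) (1 : ℂ) := by
    rw [majorana_apply, conjForm, map_sum]
    refine Finset.sum_congr rfl fun m _ => ?_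
    rw [smul_eq_C_mul, ← X_pow_mul_X_pow]
    simp
  rw [hconj, map_sum, LinearMap.sum_apply, PiLp.inner_apply, Finset.mul_sum]
  refine Finset.sum_congr rfl fun m _ => ?_
  rw [map_smul, LinearMap.smul_apply, apolar_monomial, coeff_majorana]
  have hN : ((m.val.factorial * (N - m.val).factorial : ℕ) : ℂ) * (N.choose m.val : ℂ)
      = (N.factorial : ℂ) := by
    rw [← Nat.cast_mul, mul_comm, ← mul_assoc,
      Nat.choose_mul_factorial_mul_factorial (Nat.lt_succ_iff.1 m.2)]
  have hs : ((Real.sqrt (N.choose m.val : ℝ) : ℝ) : ℂ) * ((Real.sqrt (N.choose m.val : ℝ) : ℝ) : ℂ)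
      = (N.choose m.val : ℂ) := by
    rw [← Complex.ofReal_mul, Real.mul_self_sqrt (Nat.cast_nonneg _)]; simp
  have he : ((-1 : ℂ) ^ (N - m.val)) * (-1) ^ (N - m.val) = 1 := by
    rw [← mul_pow]; simp
  simp only [smul_eq_mul, Finsupp.add_apply, Finsupp.single_apply, RCLike.inner_apply,
    starRingEnd_apply]
  simp only [Fin.isValue, one_ne_zero, zero_ne_one, if_true, if_false, add_zero, zero_add]
  rw [← hN, ← hs]
  linear_combination (star (ψ m) * φ m * ((m.val.factorial * (N - m.val).factorial : ℕ) : ℂ) *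
    ((Real.sqrt (N.choose m.val : ℝ) : ℝ) : ℂ) * ((Real.sqrt (N.choose m.val : ℝ) : ℝ) : ℂ)) * he

/-! ### Spin operators as linear vector fields -/

theorem majorana_toEuclideanLin_single (N : ℕ) (A : Matrix (Fin (N + 1)) (Fin (N + 1)) ℂ)
    (m : Fin (N + 1)) :
    majorana N (Matrix.toEuclideanLin A (EuclideanSpace.single m 1)) = ∑ i : Fin (N + 1),
      C ((-1) ^ (N - i.val) * A i m * ((Real.sqrt (N.choose i.val : ℝ) : ℝ) : ℂ)) *
        (X 0 ^ i.val * X 1 ^ (N - i.val)) := by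
  rw [majorana_apply]
  refine Finset.sum_congr rfl fun i _ => ?_
  simp [Matrix.toLpLin_apply]

/-- An operator on states corresponds to a vector field on forms as soon as it does so on the standard
basis. -/
theorem majorana_intertwine {N : ℕ} {A : Matrix (Fin (N + 1)) (Fin (N + 1)) ℂ}
    {B : Matrix (Fin 2) (Fin 2) ℂ}
    (h : ∀ m, majorana N (Matrix.toEuclideanLin A (EuclideanSpace.single m 1))
      = lieDer B (majorana N (EuclideanSpace.single m 1))) (ψ : State N) :
    majorana N (Matrix.toEuclideanLin A ψ) = lieDer B (majorana N ψ) := by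
  have : majorana N ∘ₗ Matrix.toEuclideanLin A = (lieDer B).toLinearMap ∘ₗ majorana N := by
    refine (EuclideanSpace.basisFun (Fin (N + 1)) ℂ).toBasis.ext fun m => ?_
    simpa using h m
  exact LinearMap.congr_fun this ψ

theorem lieDer_C_mul_monomial (B : Matrix (Fin 2) (Fin 2) ℂ) (c : ℂ) (a b : ℕ) :
    lieDer B (C c * (X 0 ^ a * X 1 ^ b)) =
      C c * (C (a : ℂ) * X 0 ^ (a - 1) * X 1 ^ b * (C (B 0 0) * X 0 + C (B 0 1) * X 1)
        + C (b : ℂ) * X 0 ^ a * X 1 ^ (b - 1) * (C (B 1 0) * X 0 + C (B 1 1) * X 1)) := by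
  rw [← smul_eq_C_mul, Derivation.map_smul, smul_eq_C_mul, Derivation.leibniz,
    Derivation.leibniz_pow, Derivation.leibniz_pow, lieDer_X, lieDer_X]
  simp only [Fin.sum_univ_two, smul_eq_mul, nsmul_eq_mul]
  simp only [← map_natCast (C : ℂ →+* BinaryForm)]
  ring

theorem majorana_Sz (N : ℕ) (ψ : State N) :
    majorana N (Matrix.toEuclideanLin (Sz N) ψ) = lieDer !![1 / 2, 0; 0, -1 / 2] (majorana N ψ) := by
  refine majorana_intertwine (fun m => ?_) ψ
  rw [majorana_toEuclideanLin_single, majorana_single, lieDer_C_mul_monomial,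
    Finset.sum_eq_single m]
  · have hm : m.val ≤ N := Nat.lt_succ_iff.1 m.2
    obtain ⟨b, hb⟩ := Nat.exists_eq_add_of_le hm
    have hb' : N - m.val = b := by omega
    have h0 : ∀ (i : Fin 2) (a : ℕ), C (a : ℂ) * X i ^ (a - 1) * X i = C (a : ℂ) * X i ^ a := by
      intro i a
      cases a with
      | zero => simp
      | succ a => simp [pow_succ, mul_assoc]
    have e : (N : ℂ) = m.val + b := by exact_mod_cast hb
    rw [Sz, Matrix.diagonal_apply_eq, hb']
    simp only [Matrix.of_apply, Matrix.cons_val', Matrix.cons_val_zero, Matrix.cons_val_one,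
      Matrix.cons_val_fin_one, map_zero, zero_mul, add_zero, zero_add]
    have e1 := h0 0 m.val
    have e2 := h0 1 b
    have e3 : (m.val : ℂ) - (N : ℂ) / 2 = m.val * (1 / 2) + b * (-1 / 2) := by rw [e]; ring
    rw [e3]
    simp only [C_mul, C_add]
    linear_combination (-C ((-1) ^ b) * C ((Real.sqrt (N.choose m.val : ℝ) : ℝ) : ℂ)) *
      (C (1 / 2) * X 1 ^ b * e1 + C (-1 / 2) * X 0 ^ m.val * e2)
  · intro i _ hi
    rw [Sz, Matrix.diagonal_apply_ne _ hi]
    simp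
  · simp

/-- `√((N - m) (m + 1) · C(N, m + 1)) = (N - m) √C(N, m)`. -/
theorem sqrt_mul_sqrt_choose_succ {N m : ℕ} (hm : m ≤ N) :
    ((Real.sqrt (((N : ℝ) - m) * (m + 1)) : ℝ) : ℂ)
        * ((Real.sqrt (N.choose (m + 1) : ℝ) : ℝ) : ℂ)
      = ((N - m : ℕ) : ℂ) * ((Real.sqrt (N.choose m : ℝ) : ℝ) : ℂ) := by
  have hc : (N.choose (m + 1) : ℝ) * (m + 1) = N.choose m * ((N : ℝ) - m) := by
    rw [← Nat.cast_sub hm]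
    exact_mod_cast Nat.choose_succ_right_eq N m
  have hpos : (0 : ℝ) ≤ (N : ℝ) - m := sub_nonneg.2 (Nat.cast_le.2 hm)
  have : Real.sqrt (((N : ℝ) - m) * (m + 1)) * Real.sqrt (N.choose (m + 1) : ℝ)
      = ((N : ℝ) - m) * Real.sqrt (N.choose m : ℝ) := by
    rw [← Real.sqrt_mul (by positivity), mul_assoc, mul_comm ((m : ℝ) + 1), hc,
      show ((N : ℝ) - m) * (N.choose m * ((N : ℝ) - m)) = ((N : ℝ) - m) ^ 2 * N.choose m by ring,
      Real.sqrt_mul (by positivity), Real.sqrt_sq hpos]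
  rw [← Complex.ofReal_mul, this]
  push_cast [Nat.cast_sub hm]
  rfl

/-- `√((N - m) (m + 1) · C(N, m)) = (m + 1) √C(N, m + 1)`. -/
theorem sqrt_mul_sqrt_choose {N m : ℕ} (hm : m ≤ N) :
    ((Real.sqrt (((N : ℝ) - m) * (m + 1)) : ℝ) : ℂ) * ((Real.sqrt (N.choose m : ℝ) : ℝ) : ℂ)
      = ((m + 1 : ℕ) : ℂ) * ((Real.sqrt (N.choose (m + 1) : ℝ) : ℝ) : ℂ) := by
  have hc : (N.choose (m + 1) : ℝ) * (m + 1) = N.choose m * ((N : ℝ) - m) := by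
    rw [← Nat.cast_sub hm]
    exact_mod_cast Nat.choose_succ_right_eq N m
  have hpos : (0 : ℝ) ≤ (N : ℝ) - m := sub_nonneg.2 (Nat.cast_le.2 hm)
  have : Real.sqrt (((N : ℝ) - m) * (m + 1)) * Real.sqrt (N.choose m : ℝ)
      = ((m : ℝ) + 1) * Real.sqrt (N.choose (m + 1) : ℝ) := by
    rw [← Real.sqrt_mul (by positivity),
      show ((N : ℝ) - m) * (m + 1) * N.choose m = ((m : ℝ) + 1) * (N.choose m * ((N : ℝ) - m)) by
        ring, ← hc,
      show ((m : ℝ) + 1) * (N.choose (m + 1) * (m + 1)) = ((m : ℝ) + 1) ^ 2 * N.choose (m + 1) by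
        ring,
      Real.sqrt_mul (by positivity), Real.sqrt_sq (by positivity)]
  rw [← Complex.ofReal_mul, this]
  push_cast
  rfl

/-- The raising operator is `-z ∂_w`; the sign comes from the signs in the Majorana polynomial. -/
theorem majorana_Splus (N : ℕ) (ψ : State N) :
    majorana N (Matrix.toEuclideanLin (Splus N) ψ) = lieDer !![0, 0; -1, 0] (majorana N ψ) := by
  refine majorana_intertwine (fun m => ?_) ψ
  rw [majorana_toEuclideanLin_single, majorana_single, lieDer_C_mul_monomial]
  have hm : m.val ≤ N := Nat.lt_succ_iff.1 m.2
  simp only [Matrix.of_apply, Matrix.cons_val', Matrix.cons_val_zero, Matrix.cons_val_one,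
      Matrix.cons_val_fin_one, map_zero, zero_mul, add_zero, zero_add, mul_zero]
  rcases hm.lt_or_eq with hlt | heq
  · rw [Finset.sum_eq_single (⟨m.val + 1, by omega⟩ : Fin (N + 1))]
    · obtain ⟨b, hb⟩ := Nat.exists_eq_add_of_lt hlt
      have hb' : N - m.val = b + 1 := by omega
      have hb'' : N - (m.val + 1) = b := by omega
      have key := sqrt_mul_sqrt_choose_succ hm
      simp only [Splus, Matrix.of_apply, if_true]
      rw [hb''] at *
      rw [hb'] at *
      rw [mul_assoc ((-1 : ℂ) ^ b), key]
      simp only [C_mul, map_neg, C_1, Nat.add_sub_cancel, map_pow]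
      ring
    · intro i _ hi
      have : ¬ i.val = m.val + 1 := fun h => hi (Fin.ext h)
      simp [Splus, this]
    · simp
  · rw [heq, Nat.sub_self, Finset.sum_eq_zero]
    · simp
    · intro i _
      have : ¬ i.val = m.val + 1 := by have := i.2; omega
      simp [Splus, this]

/-- The lowering operator is `-w ∂_z`. -/
theorem majorana_Sminus (N : ℕ) (ψ : State N) :
    majorana N (Matrix.toEuclideanLin (Sminus N) ψ) = lieDer !![0, -1; 0, 0] (majorana N ψ) := by
  refine majorana_intertwine (fun m => ?_) ψ
  rw [majorana_toEuclideanLin_single, majorana_single, lieDer_C_mul_monomial]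
  have hm : m.val ≤ N := Nat.lt_succ_iff.1 m.2
  simp only [Matrix.of_apply, Matrix.cons_val', Matrix.cons_val_zero, Matrix.cons_val_one,
      Matrix.cons_val_fin_one, map_zero, zero_mul, add_zero, zero_add, mul_zero]
  rcases Nat.eq_zero_or_pos m.val with h0 | hpos
  · rw [h0, Finset.sum_eq_zero]
    · simp
    · intro i _
      have : ¬ m.val = i.val + 1 := by omega
      simp [Sminus, Splus, this]
  · obtain ⟨l, hl⟩ := Nat.exists_eq_add_of_lt hpos
    rw [zero_add] at hl
    rw [Finset.sum_eq_single (⟨l, by omega⟩ : Fin (N + 1))]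
    · obtain ⟨b, hb⟩ := Nat.exists_eq_add_of_le hm
      have hb' : N - m.val = b := by omega
      have hb'' : N - l = b + 1 := by omega
      have key := sqrt_mul_sqrt_choose (show l ≤ N by omega)
      simp only [Sminus, Matrix.conjTranspose_apply, Splus, Matrix.of_apply, hl, if_true,
        Complex.star_def, Complex.conj_ofReal]
      rw [hb'', ← hl, hb', mul_assoc ((-1 : ℂ) ^ (b + 1)), key, hl]
      simp only [C_mul, map_neg, C_1, Nat.add_sub_cancel, map_pow]
      ring
    · intro i _ hi
      have : ¬ m.val = i.val + 1 := fun h => hi (Fin.ext (by simp; omega))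
      simp [Sminus, Splus, this]
    · simp

/-- The general traceless matrix, in the coordinates in which a diagonal rotation is diagonal. -/
def sl2 (x y v : ℂ) : Matrix (Fin 2) (Fin 2) ℂ := !![x, y; v, -x]

/-- The traceless matrix whose vector field represents the observable `n · S`. -/
def axisMatrix (n : EuclideanSpace ℝ (Fin 3)) : Matrix (Fin 2) (Fin 2) ℂ :=
  sl2 ((n 2 : ℂ) / 2) (-((n 0 : ℂ) + (n 1 : ℂ) * Complex.I) / 2)
    (-((n 0 : ℂ) - (n 1 : ℂ) * Complex.I) / 2)

theorem majorana_spinAlong (N : ℕ) (n : EuclideanSpace ℝ (Fin 3)) (ψ : State N) :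
    majorana N (Matrix.toEuclideanLin (spinAlong N n) ψ)
      = lieDer (axisMatrix n) (majorana N ψ) := by
  have e : axisMatrix n
      = (n 0 : ℂ) • ((1 / 2 : ℂ) • (!![0, 0; -1, 0] + !![0, -1; 0, 0]))
        + (n 1 : ℂ) • ((1 / (2 * Complex.I)) • (!![0, 0; -1, 0] + (-1 : ℂ) • (!![0, -1; 0, 0] : Matrix (Fin 2) (Fin 2) ℂ)))
        + (n 2 : ℂ) • !![1 / 2, 0; 0, -1 / 2] := by
    have hI : 1 / (2 * Complex.I) = -Complex.I / 2 := by
      field_simp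
      rw [Complex.I_sq]
      norm_num
    rw [hI]
    ext i j
    fin_cases i <;> fin_cases j <;> simp [axisMatrix, sl2] <;> ring
  rw [e]
  simp only [lieDer_add, lieDer_smul, Derivation.add_apply, Derivation.smul_apply,
    ← majorana_Sz, ← majorana_Splus, ← majorana_Sminus]
  simp only [spinAlong, Sx, Sy, map_add, map_sub, map_smul, LinearMap.add_apply,
    LinearMap.sub_apply, LinearMap.smul_apply, neg_smul, one_smul, ← sub_eq_add_neg]

theorem majorana_spinAlong_pow (N : ℕ) (n : EuclideanSpace ℝ (Fin 3)) (k : ℕ) (ψ : State N) :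
    majorana N (Matrix.toEuclideanLin (spinAlong N n ^ k) ψ)
      = (lieDer (axisMatrix n))^[k] (majorana N ψ) := by
  induction k with
  | zero => simp
  | succ k ih =>
    rw [Function.iterate_succ_apply', ← ih, ← majorana_spinAlong, pow_succ']
    congr 1
    simp [Matrix.toLpLin_apply]

/-- Expectation values of a spin state are moments of its Majorana polynomial. -/
theorem expectation_spinAlong_pow (N : ℕ) (n : EuclideanSpace ℝ (Fin 3)) (k : ℕ) (ψ : State N) :
    expectation ψ (spinAlong N n ^ k)
      = (N.factorial : ℂ)⁻¹ * moment (majorana N ψ) k (axisMatrix n) := by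
  rw [moment, ← majorana_spinAlong_pow, apolar_majorana, expectation,
    inv_mul_cancel_left₀ (Nat.cast_ne_zero.2 N.factorial_ne_zero)]

/-! ### Homogeneous polynomial functions on traceless matrices -/

/-- The monomial function `x^a y^b v^e`. -/
def monoFun (a b e : ℕ) : ℂ → ℂ → ℂ → ℂ := fun x y v => x ^ a * y ^ b * v ^ e

/-- The homogeneous polynomial functions of degree `k` in three complex variables. -/
def homFun (k : ℕ) : Submodule ℂ (ℂ → ℂ → ℂ → ℂ) :=
  Submodule.span ℂ {f | ∃ a b e, a + b + e = k ∧ f = monoFun a b e}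

/-- A homogeneous polynomial function multiplied by a monomial. -/
theorem homFun_mul {k : ℕ} {f : ℂ → ℂ → ℂ → ℂ} (hf : f ∈ homFun k) (a b e : ℕ) :
    (fun x y v => monoFun a b e x y v * f x y v) ∈ homFun (k + (a + b + e)) := by
  induction hf using Submodule.span_induction with
  | mem f hf =>
    obtain ⟨a', b', e', h, rfl⟩ := hf
    refine Submodule.subset_span ⟨a + a', b + b', e + e', by omega, ?_⟩
    funext x y v
    simp only [monoFun]
    ring
  | zero =>
    convert Submodule.zero_mem (homFun (k + (a + b + e))) using 1
    funext x y v
    simp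
  | add f g _ _ hf hg =>
    convert Submodule.add_mem _ hf hg using 1
    funext x y v
    simp [mul_add]
  | smul c f _ hf =>
    convert Submodule.smul_mem _ c hf using 1
    funext x y v
    simp only [Pi.smul_apply, smul_eq_mul]
    ring

/-- A `k`-fold product of vector fields is homogeneous polynomial in their coefficients. -/
theorem lieDer_iterate_mem_homFun (ℓ : BinaryForm →ₗ[ℂ] ℂ) (A B E : Matrix (Fin 2) (Fin 2) ℂ)
    (k : ℕ) (p : BinaryForm) :
    (fun x y v => ℓ ((lieDer (x • A + y • B + v • E))^[k] p)) ∈ homFun k := by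
  induction k generalizing p with
  | zero =>
    have h : monoFun 0 0 0 ∈ homFun 0 := Submodule.subset_span ⟨0, 0, 0, rfl, rfl⟩
    convert Submodule.smul_mem _ (ℓ p) h using 1
    funext x y v
    simp [monoFun]
  | succ k ih =>
    have hlin : ∀ (D : Derivation ℂ BinaryForm BinaryForm) (x y v : ℂ) (p q r : BinaryForm),
        D^[k] (x • p + y • q + v • r) = x • D^[k] p + y • D^[k] q + v • D^[k] r := by
      intro D x y v
      clear ih
      induction k with
      | zero => exact fun p q r => rfl
      | succ k ih' =>
        intro p q r
        simp only [Function.iterate_succ_apply', ih', map_add, Derivation.map_smul]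
    have h := Submodule.add_mem _ (Submodule.add_mem _ (homFun_mul (ih (lieDer A p)) 1 0 0)
      (homFun_mul (ih (lieDer B p)) 0 1 0)) (homFun_mul (ih (lieDer E p)) 0 0 1)
    convert h using 1
    funext x y v
    have step : lieDer (x • A + y • B + v • E) p
        = x • lieDer A p + y • lieDer B p + v • lieDer E p := by
      rw [lieDer_add, lieDer_add, lieDer_smul, lieDer_smul, lieDer_smul]
      rfl
    rw [Function.iterate_succ_apply]
    conv_lhs => rw [step, hlin]
    simp only [map_add, map_smul, smul_eq_mul, Pi.add_apply, monoFun]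
    ring

/-- Averaging over a rotation of order `n` about the polar axis leaves only the monomials
`x^a y^b v^e` with `b ≡ e` modulo `n`. -/
theorem exists_coeff_of_rotation_invariant {k n m : ℕ} (hn : n ≠ 0) {ζ : ℂ}
    (hζ : IsPrimitiveRoot ζ n) {f : ℂ → ℂ → ℂ → ℂ} (hf : f ∈ homFun k)
    (hinv : ∀ x y v, f x (ζ * y) (ζ⁻¹ * v) = f x y v) (g : Fin m → ℂ → ℂ → ℂ → ℂ)
    (hg : ∀ a b e : ℕ, a + b + e = k → (n : ℤ) ∣ (b : ℤ) - e → ∃ i, g i = monoFun a b e) :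
    ∃ c : Fin m → ℂ, ∀ x y v, f x y v = ∑ i, c i * g i x y v := by
  have hζ0 : ζ ≠ 0 := hζ.ne_zero hn
  have havg : ∀ f ∈ homFun k, (fun x y v => ∑ i ∈ Finset.range n, f x (ζ ^ i * y) (ζ⁻¹ ^ i * v))
      ∈ Submodule.span ℂ (Set.range g) := by
    intro f hf
    induction hf using Submodule.span_induction with
    | mem f hf =>
      obtain ⟨a, b, e, h, rfl⟩ := hf
      set ξ : ℂ := ζ ^ ((b : ℤ) - e) with hξ
      have hξ' : ξ = ζ ^ b * ζ⁻¹ ^ e := by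
        rw [hξ, zpow_sub₀ hζ0, zpow_natCast, zpow_natCast, inv_pow, div_eq_mul_inv]
      have hsum : (fun x y v => ∑ i ∈ Finset.range n,
          monoFun a b e x (ζ ^ i * y) (ζ⁻¹ ^ i * v))
          = (∑ i ∈ Finset.range n, ξ ^ i) • monoFun a b e := by
        funext x y v
        simp only [Pi.smul_apply, smul_eq_mul, Finset.sum_mul]
        refine Finset.sum_congr rfl fun i _ => ?_
        simp only [monoFun, hξ', mul_pow, ← pow_mul]
        rw [mul_comm i b, mul_comm i e]
        ring
      rw [hsum]
      by_cases hd : (n : ℤ) ∣ (b : ℤ) - e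
      · obtain ⟨i, hi⟩ := hg a b e h hd
        exact Submodule.smul_mem _ _ (Submodule.subset_span ⟨i, hi⟩)
      · have hne : ξ ≠ 1 := fun h1 => hd ((hζ.zpow_eq_one_iff_dvd _).1 h1)
        have hpow : ξ ^ n = 1 := by
          rw [hξ, ← zpow_natCast, ← zpow_mul, mul_comm, zpow_mul, zpow_natCast, hζ.pow_eq_one,
            one_zpow]
        rw [geom_sum_eq hne, hpow, sub_self, zero_div, zero_smul]
        exact Submodule.zero_mem _
    | zero =>
      convert Submodule.zero_mem (Submodule.span ℂ (Set.range g)) using 1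
      funext x y v
      simp
    | add f g _ _ hf hg =>
      convert Submodule.add_mem _ hf hg using 1
      funext x y v
      simp [Finset.sum_add_distrib]
    | smul c f _ hf =>
      convert Submodule.smul_mem _ c hf using 1
      funext x y v
      simp [Finset.mul_sum]
  -- An invariant function is equal to its average.
  have hinv' : ∀ (i : ℕ) (x y v : ℂ), f x (ζ ^ i * y) (ζ⁻¹ ^ i * v) = f x y v := by
    intro i
    induction i with
    | zero => simp
    | succ i ih =>
      intro x y v
      rw [pow_succ', pow_succ', mul_assoc, mul_assoc, hinv, ih]
  have hmem : f ∈ Submodule.span ℂ (Set.range g) := by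
    have h := Submodule.smul_mem _ (n : ℂ)⁻¹ (havg f hf)
    convert h using 1
    funext x y v
    simp only [hinv', Pi.smul_apply, Finset.sum_const, Finset.card_range, nsmul_eq_mul,
      smul_eq_mul]
    rw [inv_mul_cancel_left₀ (Nat.cast_ne_zero.2 hn)]
  obtain ⟨c, hc⟩ := (Submodule.mem_span_range_iff_exists_fun ℂ).1 hmem
  refine ⟨c, fun x y v => ?_⟩
  rw [← hc]
  simp

/-! ### The adjoint action of the binary polyhedral groups -/

/-- The adjoint action of `SU(2)` in the coordinates of `sl2`. -/
theorem su2_conj_sl2 (a b : ℂ) (hab : a * star a + b * star b = 1) (x y v : ℂ) :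
    (su2 a b hab).val * sl2 x y v * ((su2 a b hab)⁻¹).val =
      sl2 (x * (a * star a - b * star b) + y * (a * star b) + v * (star a * b))
        (-2 * a * b * x + a ^ 2 * y - b ^ 2 * v)
        (-2 * star a * star b * x - star b ^ 2 * y + star a ^ 2 * v) := by
  have hinv : ((su2 a b hab)⁻¹).val = star (su2 a b hab).val := rfl
  rw [hinv]
  ext i j
  fin_cases i <;> fin_cases j <;>
    simp [su2, sl2, Matrix.mul_apply, Fin.sum_univ_two, Matrix.star_apply] <;> ring

theorem diagRot_conj_sl2 (θ x y v : ℂ) (t : ℝ) (ht : Complex.exp (t * Complex.I) ^ 2 = θ) :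
    (diagRot t).val * sl2 x y v * ((diagRot t)⁻¹).val = sl2 x (θ * y) (θ⁻¹ * v) := by
  have h := exp_mul_star t
  rw [diagRot, su2_conj_sl2, ← ht]
  have h' : star (Complex.exp (t * Complex.I)) = (Complex.exp (t * Complex.I))⁻¹ := by
    refine eq_inv_of_mul_eq_one_left ?_
    simpa [mul_comm] using h
  rw [h', mul_inv_cancel₀ (Complex.exp_ne_zero _)]
  congr 1 <;> simp

theorem swapJ_conj_sl2 (x y v : ℂ) :
    swapJ.val * sl2 x y v * (swapJ⁻¹).val = sl2 (-x) (-v) (-y) := by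
  rw [swapJ, su2_conj_sl2]
  congr 1 <;> simp

/-- The rotation of order three permutes the coordinate axes. -/
theorem rotThree_conj_sl2 (x y v : ℂ) :
    rotThree.val * sl2 x y v * (rotThree⁻¹).val
      = sl2 ((y + v) / 2) (Complex.I * (y / 2 - v / 2 - x)) (Complex.I * (x + y / 2 - v / 2)) := by
  have hI := Complex.I_sq
  rw [rotThree, su2_conj_sl2]
  simp only [Complex.star_def, map_div₀, map_add, map_one, Complex.conj_I, map_ofNat]
  congr 1
  · linear_combination (-(y + v) / 4) * hI
  · linear_combination (-x / 2 + y / 4 - v / 4) * hI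
  · linear_combination (-x / 2 - y / 4 + v / 4) * hI

/-- The entries of the icosahedral rotation in terms of the golden ratio `φ`. -/
theorem icosaRot_val : ∃ b : ℝ, 0 < b ∧ 5 * b ^ 2 = 3 - Real.goldenRatio ∧
    icosaRot.val = !![-((Real.goldenRatio * b : ℝ) * Complex.I), b * Complex.I;
      b * Complex.I, (Real.goldenRatio * b : ℝ) * Complex.I] := by
  have hpi := Real.pi_pos
  have hφ : 2 * Real.cos (Real.pi / 5) = Real.goldenRatio := by
    rw [Real.cos_pi_div_five, Real.goldenRatio]
    ring
  have h5 : Real.sqrt 5 ^ 2 = 5 := Real.sq_sqrt (by norm_num)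
  have h5' : Real.sqrt 5 ≠ 0 := by positivity
  have hsin : Real.sin (2 * Real.pi / 5) = Real.goldenRatio * Real.sin (Real.pi / 5) := by
    rw [← hφ, mul_right_comm, ← Real.sin_two_mul]
    congr 1
    ring
  refine ⟨2 * Real.sin (Real.pi / 5) / Real.sqrt 5, ?_, ?_, ?_⟩
  · have : 0 < Real.sin (Real.pi / 5) := Real.sin_pos_of_pos_of_lt_pi (by positivity) (by linarith)
    positivity
  · have h1 : Real.sin (Real.pi / 5) ^ 2 = 1 - Real.goldenRatio ^ 2 / 4 := by
      rw [← hφ]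
      linarith [Real.sin_sq_add_cos_sq (Real.pi / 5)]
    rw [div_pow, h5, mul_pow, h1, Real.goldenRatio_sq]
    ring
  · have h2 : 2 * Real.sin (2 * Real.pi / 5) / Real.sqrt 5
        = Real.goldenRatio * (2 * Real.sin (Real.pi / 5) / Real.sqrt 5) := by
      rw [hsin]
      ring
    rw [← h2]
    simp only [icosaRot, su2, Complex.star_def, map_mul, map_neg, Complex.conj_I,
      Complex.conj_ofReal]
    simp only [mul_neg, neg_mul, neg_neg]

/-- The adjoint action of the icosahedral rotation. Its entries are `∓ a i` and `b i` with `a, b`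
real, so the formulas involve no conjugates. -/
theorem icosaRot_conj_sl2 : ∃ a b : ℝ, 0 < a ∧ 0 < b ∧ a ^ 2 + b ^ 2 = 1 ∧ ∀ x y v : ℂ,
    icosaRot.val * sl2 x y v * (icosaRot⁻¹).val =
      sl2 (x * (a ^ 2 - b ^ 2) - (y + v) * (a * b)) (-2 * a * b * x - a ^ 2 * y + b ^ 2 * v)
        (-2 * a * b * x + b ^ 2 * y - a ^ 2 * v) := by
  obtain ⟨b, hb, hb5, hQ⟩ := icosaRot_val
  refine ⟨Real.goldenRatio * b, b, mul_pos Real.goldenRatio_pos hb, hb, ?_, fun x y v => ?_⟩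
  · rw [mul_pow, Real.goldenRatio_sq]
    linear_combination (Real.goldenRatio + 2) / 5 * hb5 - Real.goldenRatio_sq / 5
  · have hinv : (icosaRot⁻¹).val = star icosaRot.val := rfl
    have hI := Complex.I_sq
    generalize Real.goldenRatio * b = a at hQ
    rw [hinv, hQ]
    ext i j
    fin_cases i <;> fin_cases j <;>
      simp [sl2, Matrix.mul_apply, Fin.sum_univ_two, Matrix.star_apply] <;> ring_nf <;>
      rw [hI] <;> ring

/-! ### Invariant functions of low degree are isotropic -/

/-- The matrix `diagRot (π / n)` acts on traceless matrices as a rotation of order `n`. -/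
theorem isPrimitiveRoot_exp_sq {t : ℝ} {n : ℕ} (hn : n ≠ 0) (ht : t = Real.pi / n) :
    IsPrimitiveRoot (Complex.exp (t * Complex.I) ^ 2) n := by
  have h := Complex.isPrimitiveRoot_exp n hn
  convert h using 1
  rw [← Complex.exp_nat_mul, ht]
  congr 1
  push_cast
  ring

/-- A function on matrices that is homogeneous polynomial of degree `k` on traceless matrices and
invariant under conjugation by a subgroup `G` of `SU(2)`. -/
structure IsConjInvariant (G : Subgroup SU2) (k : ℕ) (Φ : Matrix (Fin 2) (Fin 2) ℂ → ℂ) :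
    Prop where
  poly : (fun x y v => Φ (sl2 x y v)) ∈ homFun k
  inv : ∀ g ∈ G, ∀ A, Φ (g.val * A * (g⁻¹).val) = Φ A

namespace IsConjInvariant

variable {G : Subgroup SU2} {k : ℕ} {Φ : Matrix (Fin 2) (Fin 2) ℂ → ℂ}

/-- The expansion of an invariant function in the monomials allowed by a rotation about the polar
axis. -/
theorem expand (h : IsConjInvariant G k Φ) {n m : ℕ} {t : ℝ} (hn : n ≠ 0)
    (hζ : IsPrimitiveRoot (Complex.exp (t * Complex.I) ^ 2) n) (ht : diagRot t ∈ G)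
    (g : Fin m → ℂ → ℂ → ℂ → ℂ)
    (hg : ∀ a b e : ℕ, a + b + e = k → (n : ℤ) ∣ (b : ℤ) - e → ∃ i, g i = monoFun a b e) :
    ∃ c : Fin m → ℂ, ∀ x y v, Φ (sl2 x y v) = ∑ i, c i * g i x y v := by
  refine exists_coeff_of_rotation_invariant hn hζ h.poly (fun x y v => ?_) g hg
  rw [← diagRot_conj_sl2 _ x y v t rfl, h.inv _ ht]

theorem swap (h : IsConjInvariant G k Φ) (hJ : swapJ ∈ G) (x y v : ℂ) :
    Φ (sl2 (-x) (-v) (-y)) = Φ (sl2 x y v) := by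
  rw [← swapJ_conj_sl2, h.inv _ hJ]

theorem degree_zero (h : IsConjInvariant G 0 Φ) : ∃ c, ∀ x y v, Φ (sl2 x y v) = c := by
  obtain ⟨c, hc⟩ := h.expand (n := 1) (t := 0) one_ne_zero (by simp) (by
    have : diagRot 0 = 1 := by
      ext i j
      fin_cases i <;> fin_cases j <;> simp [diagRot, su2]
    rw [this]
    exact G.one_mem) ![monoFun 0 0 0] (by
    intro a b e hab _
    obtain ⟨rfl, rfl, rfl⟩ : a = 0 ∧ b = 0 ∧ e = 0 := by omega
    exact ⟨0, rfl⟩)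
  exact ⟨c 0, fun x y v => by rw [hc]; simp [monoFun]⟩

theorem degree_one (h : IsConjInvariant G 1 Φ) (hJ : swapJ ∈ G) {n : ℕ} {t : ℝ} (hn : 2 ≤ n)
    (hζ : IsPrimitiveRoot (Complex.exp (t * Complex.I) ^ 2) n) (ht : diagRot t ∈ G) (x y v : ℂ) :
    Φ (sl2 x y v) = 0 := by
  obtain ⟨c, hc⟩ := h.expand (by omega) hζ ht ![monoFun 1 0 0] (by
    intro a b e hab hd
    have hb : b ≤ 1 := by omega
    have he : e ≤ 1 := by omega
    have hd' := Int.eq_zero_of_abs_lt_dvd hd (by rw [abs_lt]; omega)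
    obtain ⟨rfl, rfl, rfl⟩ : a = 1 ∧ b = 0 ∧ e = 0 := by omega
    exact ⟨0, rfl⟩)
  have hΦ : ∀ x y v, Φ (sl2 x y v) = c 0 * x :=
    fun x y v => by rw [hc]; simp [monoFun]
  have h1 := h.swap hJ x y v
  rw [hΦ, hΦ] at h1
  rw [hΦ]
  linear_combination (-1 / 2 : ℂ) * h1

/-- An invariant quadratic form is a combination of `x²`, `y v` and `y² + v²`; the values at two
matrices and at their rotations of order three force it to be a multiple of `x² + y v`. -/
theorem degree_two_tetrahedral (h : IsConjInvariant G 2 Φ) (hJ : swapJ ∈ G) (hR : rotThree ∈ G)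
    {t : ℝ} (hζ : IsPrimitiveRoot (Complex.exp (t * Complex.I) ^ 2) 2) (ht : diagRot t ∈ G) :
    ∃ c, ∀ x y v, Φ (sl2 x y v) = c * (x ^ 2 + y * v) := by
  obtain ⟨c, hc⟩ := h.expand (by omega) hζ ht
    ![monoFun 2 0 0, monoFun 0 1 1, monoFun 0 2 0, monoFun 0 0 2] (by
    intro a b e hab hd
    have hb : b ≤ 2 := by omega
    have he : e ≤ 2 := by omega
    obtain rfl : a = 2 - b - e := by omega
    interval_cases b <;> interval_cases e <;>
      first
      | omega
      | exact ⟨0, rfl⟩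
      | exact ⟨1, rfl⟩
      | exact ⟨2, rfl⟩
      | exact ⟨3, rfl⟩)
  have hΦ : ∀ x y v, Φ (sl2 x y v) = c 0 * x ^ 2 + c 1 * (y * v) + c 2 * y ^ 2 + c 3 * v ^ 2 :=
    fun x y v => by rw [hc]; simp [Fin.sum_univ_four, monoFun]
  have h1 := h.swap hJ 0 1 0
  have h2 := h.inv _ hR (sl2 1 0 0)
  have h3 := h.inv _ hR (sl2 0 1 0)
  rw [rotThree_conj_sl2] at h2 h3
  rw [hΦ, hΦ] at h1 h2 h3
  have hI := Complex.I_sq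
  have e1 : c 3 = c 2 := by linear_combination h1
  have e2 : c 1 = c 0 + 2 * c 2 := by
    linear_combination h2 + (c 1 - c 2 - c 3) * hI + e1
  have e3 : c 2 = 0 := by
    linear_combination (-1 / 8 : ℂ) * (4 * h3 - (c 1 + c 2 + c 3) * hI + e1 + e2)
  refine ⟨c 0, fun x y v => ?_⟩
  rw [hΦ]
  linear_combination (v ^ 2) * e1 + (y * v) * e2 + (2 * (y * v) + y ^ 2 + v ^ 2) * e3

theorem degree_three (h : IsConjInvariant G 3 Φ) (hJ : swapJ ∈ G) {n : ℕ} {t : ℝ} (hn : 4 ≤ n)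
    (hζ : IsPrimitiveRoot (Complex.exp (t * Complex.I) ^ 2) n) (ht : diagRot t ∈ G) (x y v : ℂ) :
    Φ (sl2 x y v) = 0 := by
  obtain ⟨c, hc⟩ := h.expand (by omega) hζ ht ![monoFun 3 0 0, monoFun 1 1 1] (by
    intro a b e hab hd
    have hb : b ≤ 3 := by omega
    have he : e ≤ 3 := by omega
    have hd' := Int.eq_zero_of_abs_lt_dvd hd (by rw [abs_lt]; omega)
    obtain ⟨rfl, rfl, rfl⟩ | ⟨rfl, rfl, rfl⟩ :
      (a = 3 ∧ b = 0 ∧ e = 0) ∨ (a = 1 ∧ b = 1 ∧ e = 1) := by omega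
    · exact ⟨0, rfl⟩
    · exact ⟨1, rfl⟩)
  have hΦ : ∀ x y v, Φ (sl2 x y v) = c 0 * x ^ 3 + c 1 * (x * y * v) :=
    fun x y v => by rw [hc]; simp [Fin.sum_univ_two, monoFun]
  have h1 := h.swap hJ x y v
  rw [hΦ, hΦ] at h1
  rw [hΦ]
  linear_combination (-1 / 2 : ℂ) * h1

/-- The icosahedral rotation takes the nilpotent matrix `sl2 0 1 0`, where the function vanishes, to a
matrix with `y v = -x² ≠ 0`, which compares the two coefficients. -/
theorem degree_two_icosahedral (h : IsConjInvariant G 2 Φ) (hQ : icosaRot ∈ G)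
    {t : ℝ} (hζ : IsPrimitiveRoot (Complex.exp (t * Complex.I) ^ 2) 5) (ht : diagRot t ∈ G) :
    ∃ c, ∀ x y v, Φ (sl2 x y v) = c * (x ^ 2 + y * v) := by
  obtain ⟨c, hc⟩ := h.expand (by omega) hζ ht ![monoFun 2 0 0, monoFun 0 1 1] (by
    intro a b e hab hd
    have hd' := Int.eq_zero_of_abs_lt_dvd hd (by rw [abs_lt]; omega)
    obtain ⟨rfl, rfl, rfl⟩ | ⟨rfl, rfl, rfl⟩ :
      (a = 2 ∧ b = 0 ∧ e = 0) ∨ (a = 0 ∧ b = 1 ∧ e = 1) := by omega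
    · exact ⟨0, rfl⟩
    · exact ⟨1, rfl⟩)
  have hΦ : ∀ x y v, Φ (sl2 x y v) = c 0 * x ^ 2 + c 1 * (y * v) :=
    fun x y v => by rw [hc]; simp [Fin.sum_univ_two, monoFun]
  obtain ⟨a, b, ha, hb, hab, hconj⟩ := icosaRot_conj_sl2
  have h3 := h.inv _ hQ (sl2 0 1 0)
  rw [hconj, hΦ, hΦ] at h3
  have ha' : (a : ℂ) ≠ 0 := Complex.ofReal_ne_zero.2 ha.ne'
  have hb' : (b : ℂ) ≠ 0 := Complex.ofReal_ne_zero.2 hb.ne'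
  have e : c 1 = c 0 := by
    have : ((a : ℂ) * b) ^ 2 * (c 1 - c 0) = 0 := by linear_combination -h3
    rcases mul_eq_zero.1 this with h0 | h0
    · exact absurd h0 (by positivity)
    · linear_combination h0
  refine ⟨c 0, fun x y v => ?_⟩
  rw [hΦ, e]
  ring

/-- The values at a nilpotent matrix and at the polar axis, and at their images under the icosahedral
rotation, determine the three coefficients up to a common factor. -/
theorem degree_four_icosahedral (h : IsConjInvariant G 4 Φ) (hQ : icosaRot ∈ G)
    {t : ℝ} (hζ : IsPrimitiveRoot (Complex.exp (t * Complex.I) ^ 2) 5) (ht : diagRot t ∈ G) :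
    ∃ c, ∀ x y v, Φ (sl2 x y v) = c * (x ^ 2 + y * v) ^ 2 := by
  obtain ⟨c, hc⟩ := h.expand (by omega) hζ ht
    ![monoFun 4 0 0, monoFun 2 1 1, monoFun 0 2 2] (by
    intro a b e hab hd
    have hd' := Int.eq_zero_of_abs_lt_dvd hd (by rw [abs_lt]; omega)
    obtain ⟨rfl, rfl, rfl⟩ | ⟨rfl, rfl, rfl⟩ | ⟨rfl, rfl, rfl⟩ :
      (a = 4 ∧ b = 0 ∧ e = 0) ∨ (a = 2 ∧ b = 1 ∧ e = 1) ∨ (a = 0 ∧ b = 2 ∧ e = 2) := by omega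
    · exact ⟨0, rfl⟩
    · exact ⟨1, rfl⟩
    · exact ⟨2, rfl⟩)
  have hΦ : ∀ x y v, Φ (sl2 x y v) = c 0 * x ^ 4 + c 1 * (x ^ 2 * y * v) + c 2 * (y ^ 2 * v ^ 2) :=
    fun x y v => by rw [hc]; simp [Fin.sum_univ_three, monoFun]
  obtain ⟨a, b, ha, hb, hab, hconj⟩ := icosaRot_conj_sl2
  have hab' : (a : ℂ) ^ 2 + (b : ℂ) ^ 2 = 1 := by exact_mod_cast hab
  have h2 := h.inv _ hQ (sl2 1 0 0)
  have h3 := h.inv _ hQ (sl2 0 1 0)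
  rw [hconj, hΦ, hΦ] at h2 h3
  have hab0 : (a : ℂ) * b ≠ 0 :=
    mul_ne_zero (Complex.ofReal_ne_zero.2 ha.ne') (Complex.ofReal_ne_zero.2 hb.ne')
  have e1 : c 1 = c 0 + c 2 := by
    have : ((a : ℂ) * b) ^ 4 * (c 0 - c 1 + c 2) = 0 := by linear_combination h3
    rcases mul_eq_zero.1 this with h0 | h0
    · exact absurd h0 (pow_ne_zero _ hab0)
    · linear_combination -h0
  -- With `s = 4 a² b²`, the polar axis is sent to a matrix with `x² = 1 - s` and `y v = s`.
  have e2 : c 2 = c 0 := by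
    have hs : ((a : ℂ) ^ 2 - b ^ 2) ^ 2 = 1 - 4 * (a * b) ^ 2 := by
      linear_combination ((a : ℂ) ^ 2 + b ^ 2 + 1) * hab'
    have : (4 * ((a : ℂ) * b) ^ 2) * (c 2 - c 0) = 0 := by
      linear_combination h2 - (c 0 * (((a : ℂ) ^ 2 - b ^ 2) ^ 2 + 1 - 4 * (a * b) ^ 2)
        + c 1 * (4 * (a * b) ^ 2)) * hs - (4 * (a * b) ^ 2 * (1 - 4 * (a * b) ^ 2)) * e1
    rcases mul_eq_zero.1 this with h0 | h0
    · exact absurd h0 (mul_ne_zero (by norm_num) (pow_ne_zero _ hab0))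
    · linear_combination h0
  refine ⟨c 0, fun x y v => ?_⟩
  rw [hΦ, e1, e2]
  ring

/-- The only candidate is a multiple of `y⁵ - v⁵`, which takes values of opposite signs at a nilpotent
matrix and at its image under the icosahedral rotation. -/
theorem degree_five_icosahedral (h : IsConjInvariant G 5 Φ) (hJ : swapJ ∈ G) (hQ : icosaRot ∈ G)
    {t : ℝ} (hζ : IsPrimitiveRoot (Complex.exp (t * Complex.I) ^ 2) 5) (ht : diagRot t ∈ G)
    (x y v : ℂ) : Φ (sl2 x y v) = 0 := by
  obtain ⟨c, hc⟩ := h.expand (by omega) hζ ht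
    ![monoFun 5 0 0, monoFun 3 1 1, monoFun 1 2 2, monoFun 0 5 0, monoFun 0 0 5] (by
    intro a b e hab hd
    have hb : b ≤ 5 := by omega
    have he : e ≤ 5 := by omega
    obtain rfl : a = 5 - b - e := by omega
    interval_cases b <;> interval_cases e <;>
      first
      | omega
      | exact ⟨0, rfl⟩
      | exact ⟨1, rfl⟩
      | exact ⟨2, rfl⟩
      | exact ⟨3, rfl⟩
      | exact ⟨4, rfl⟩)
  have hΦ : ∀ x y v, Φ (sl2 x y v) = c 0 * x ^ 5 + c 1 * (x ^ 3 * y * v)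
      + c 2 * (x * y ^ 2 * v ^ 2) + c 3 * y ^ 5 + c 4 * v ^ 5 :=
    fun x y v => by rw [hc]; simp [Fin.sum_univ_five, monoFun]
  -- The half turn leaves only the multiples of `y^5 - v^5`.
  have hΦ' : ∀ x y v, Φ (sl2 x y v) = (c 3 - c 4) / 2 * (y ^ 5 - v ^ 5) := fun x y v => by
    have h1 := h.swap hJ x y v
    rw [hΦ, hΦ] at h1
    rw [hΦ]
    linear_combination (-1 / 2 : ℂ) * h1
  obtain ⟨a, b, ha, hb, hab, hconj⟩ := icosaRot_conj_sl2
  have h3 := h.inv _ hQ (sl2 0 1 0)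
  rw [hconj, hΦ', hΦ'] at h3
  have hpos : (1 + (a : ℂ) ^ 10 + (b : ℂ) ^ 10) ≠ 0 := by
    have : (1 + a ^ 10 + b ^ 10 : ℝ) ≠ 0 := by positivity
    exact_mod_cast this
  have h0 : (c 3 - c 4) / 2 * (1 + (a : ℂ) ^ 10 + (b : ℂ) ^ 10) = 0 := by
    linear_combination -h3
  rw [hΦ', (mul_eq_zero.1 h0).resolve_right hpos, zero_mul]

end IsConjInvariant

/-- For `k` at most the order of the table, an invariant function of degree `k` takes a single value
on the traceless matrices with given determinant: the rotation group has no invariant harmonic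
polynomial of degree `1, …, k`. -/
theorem IsConjInvariant.isotropic {T : PolyhedralType} {k : ℕ} (hk : k ≤ T.order)
    {Φ : Matrix (Fin 2) (Fin 2) ℂ → ℂ} (h : IsConjInvariant T.group k Φ) :
    ∃ c, ∀ x y v, x ^ 2 + y * v = 1 / 4 → Φ (sl2 x y v) = c := by
  rcases Nat.eq_zero_or_pos k with rfl | hpos
  · obtain ⟨c, hc⟩ := h.degree_zero
    exact ⟨c, fun x y v _ => hc x y v⟩
  have hquad : (∃ c, ∀ x y v, Φ (sl2 x y v) = c * (x ^ 2 + y * v)) →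
      ∃ c, ∀ x y v, x ^ 2 + y * v = 1 / 4 → Φ (sl2 x y v) = c := fun ⟨c, hc⟩ =>
    ⟨c * (1 / 4), fun x y v hx => by rw [hc, hx]⟩
  cases T with
  | dihedral n hn =>
    have hg : ({diagRot (Real.pi / n), swapJ} : Set SU2) ⊆
        (PolyhedralType.dihedral n hn).group := Subgroup.subset_closure
    have hD := hg (Set.mem_insert _ _)
    have hJ := hg (Set.mem_insert_of_mem _ rfl)
    have hζ := isPrimitiveRoot_exp_sq (t := Real.pi / n) (n := n) (by omega) rfl
    obtain rfl : k = 1 := le_antisymm hk hpos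
    exact ⟨0, fun x y v _ => h.degree_one hJ hn hζ hD x y v⟩
  | tetrahedral =>
    have hg : ({diagRot (Real.pi / 2), swapJ, rotThree} : Set SU2) ⊆
        PolyhedralType.tetrahedral.group := Subgroup.subset_closure
    have hD := hg (by simp : diagRot (Real.pi / 2) ∈ _)
    have hJ := hg (by simp : swapJ ∈ _)
    have hR := hg (by simp : rotThree ∈ _)
    have hζ := isPrimitiveRoot_exp_sq (t := Real.pi / 2) (n := 2) (by omega) (by norm_num)
    have hk' : k ≤ 2 := hk
    interval_cases k
    · exact ⟨0, fun x y v _ => h.degree_one hJ le_rfl hζ hD x y v⟩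
    · exact hquad (h.degree_two_tetrahedral hJ hR hζ hD)
  | octahedral =>
    have hg : ({diagRot (Real.pi / 4), swapJ, rotThree} : Set SU2) ⊆
        PolyhedralType.octahedral.group := Subgroup.subset_closure
    have hD := hg (by simp : diagRot (Real.pi / 4) ∈ _)
    have hJ := hg (by simp : swapJ ∈ _)
    have hR := hg (by simp : rotThree ∈ _)
    have hζ := isPrimitiveRoot_exp_sq (t := Real.pi / 4) (n := 4) (by omega) (by norm_num)
    have hk' : k ≤ 3 := hk
    interval_cases k
    · exact ⟨0, fun x y v _ => h.degree_one hJ (by norm_num) hζ hD x y v⟩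
    · -- The octahedral group contains the half turn about the polar axis.
      have hsq : diagRot (Real.pi / 2) = diagRot (Real.pi / 4) * diagRot (Real.pi / 4) := by
        have he : Complex.exp ((Real.pi / 2 : ℝ) * Complex.I)
            = Complex.exp ((Real.pi / 4 : ℝ) * Complex.I)
              * Complex.exp ((Real.pi / 4 : ℝ) * Complex.I) := by
          rw [← Complex.exp_add]
          congr 1
          push_cast
          ring
        apply Subtype.ext
        rw [Submonoid.coe_mul]
        simp only [diagRot, su2, he]
        ext i j
        fin_cases i <;> fin_cases j <;> simp [Matrix.mul_apply, Fin.sum_univ_two]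
      have hζ' := isPrimitiveRoot_exp_sq (t := Real.pi / 2) (n := 2) (by omega) (by norm_num)
      refine hquad (h.degree_two_tetrahedral hJ hR hζ' ?_)
      rw [hsq]
      exact Subgroup.mul_mem _ hD hD
    · exact ⟨0, fun x y v _ => h.degree_three hJ le_rfl hζ hD x y v⟩
  | icosahedral =>
    have hg : ({diagRot (6 * Real.pi / 5), swapJ, icosaRot} : Set SU2) ⊆
        PolyhedralType.icosahedral.group := Subgroup.subset_closure
    have hD := hg (by simp : diagRot (6 * Real.pi / 5) ∈ _)
    have hJ := hg (by simp : swapJ ∈ _)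
    have hQ := hg (by simp : icosaRot ∈ _)
    have hζ : IsPrimitiveRoot (Complex.exp ((6 * Real.pi / 5 : ℝ) * Complex.I) ^ 2) 5 := by
      convert Complex.isPrimitiveRoot_exp 5 (by norm_num) using 1
      rw [← Complex.exp_nat_mul]
      refine Eq.trans ?_ (Complex.exp_periodic _)
      congr 1
      push_cast
      ring
    have hk' : k ≤ 5 := hk
    interval_cases k
    · exact ⟨0, fun x y v _ => h.degree_one hJ (by norm_num) hζ hD x y v⟩
    · exact hquad (h.degree_two_icosahedral hQ hζ hD)
    · exact ⟨0, fun x y v _ => h.degree_three hJ (by norm_num) hζ hD x y v⟩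
    · obtain ⟨c, hc⟩ := h.degree_four_icosahedral hQ hζ hD
      exact ⟨c * (1 / 4) ^ 2, fun x y v hx => by rw [hc, hx]⟩
    · exact ⟨0, fun x y v _ => h.degree_five_icosahedral hJ hQ hζ hD x y v⟩

/-! ### Anticoherence of invariant states -/

theorem eq_sl2_of_trace_eq_zero {A : Matrix (Fin 2) (Fin 2) ℂ} (h : A.trace = 0) :
    A = sl2 (A 0 0) (A 0 1) (A 1 0) := by
  rw [Matrix.trace_fin_two] at h
  ext i j
  fin_cases i <;> fin_cases j <;> simp [sl2]
  linear_combination h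

/-- A state whose Majorana polynomial is invariant under a binary polyhedral group, in any position,
is anticoherent of the order in the table. -/
theorem isAnticoherent_of_invariant {T : PolyhedralType} {G : Subgroup SU2} (hG : T.IsOfType G)
    {N : ℕ} {ψ : State N} (hψ : IsInvariant G (majorana N ψ)) : IsAnticoherent T.order ψ := by
  obtain ⟨g, rfl⟩ := hG
  intro k hk
  set p := majorana N ψ with hp
  have hgg : g.val * (g⁻¹).val = 1 := by
    rw [← Submonoid.coe_mul, mul_inv_cancel, Submonoid.coe_one]
  have hgg' : (g⁻¹).val * g.val = 1 := by
    rw [← Submonoid.coe_mul, inv_mul_cancel, Submonoid.coe_one]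
  -- The group is moved to its standard position by conjugating the argument of the moment.
  have hΦ : IsConjInvariant T.group k fun A => moment p k (g.val * A * (g⁻¹).val) := by
    constructor
    · have hlin : ∀ x y v : ℂ, g.val * sl2 x y v * (g⁻¹).val
          = x • (g.val * sl2 1 0 0 * (g⁻¹).val) + y • (g.val * sl2 0 1 0 * (g⁻¹).val)
            + v • (g.val * sl2 0 0 1 * (g⁻¹).val) := by
        intro x y v
        have : sl2 x y v = x • sl2 1 0 0 + y • sl2 0 1 0 + v • sl2 0 0 1 := by
          ext i j
          fin_cases i <;> fin_cases j <;> simp [sl2]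
        rw [this]
        simp only [mul_add, add_mul, mul_smul_comm, smul_mul_assoc]
      have hmoment := lieDer_iterate_mem_homFun (apolar (conjForm p))
        (g.val * sl2 1 0 0 * (g⁻¹).val) (g.val * sl2 0 1 0 * (g⁻¹).val)
        (g.val * sl2 0 0 1 * (g⁻¹).val) k p
      convert hmoment using 4 with x y v
      rw [moment, hlin x y v]
    · intro t ht A
      have hmem : g * t * g⁻¹ ∈ T.group.map (MulAut.conj g).toMonoidHom := ⟨t, ht, rfl⟩
      have h := moment_conj (hψ _ hmem) k (g.val * A * (g⁻¹).val)
      rw [← h]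
      congr 1
      rw [mul_inv_rev, mul_inv_rev, inv_inv]
      simp only [Submonoid.coe_mul, mul_assoc]
      rw [← mul_assoc (g⁻¹).val g.val, hgg', one_mul, ← mul_assoc (g⁻¹).val g.val, hgg', one_mul]
  obtain ⟨c, hc⟩ := hΦ.isotropic hk
  refine ⟨(N.factorial : ℂ)⁻¹ * c, fun n hn => ?_⟩
  rw [expectation_spinAlong_pow, ← hp]
  congr 1
  set A := (g⁻¹).val * axisMatrix n * g.val with hA
  have hA' : g.val * A * (g⁻¹).val = axisMatrix n := by
    rw [hA]
    simp only [mul_assoc]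
    rw [hgg, mul_one, ← mul_assoc, hgg, one_mul]
  have htr : A.trace = 0 := by
    rw [hA, Matrix.trace_mul_comm, ← mul_assoc, hgg, one_mul]
    simp [axisMatrix, sl2, Matrix.trace_fin_two]
  have hdet : A.det = -1 / 4 := by
    rw [hA, Matrix.det_mul, Matrix.det_mul, mul_right_comm, ← Matrix.det_mul, hgg', Matrix.det_one,
      one_mul]
    have hn' : n 0 ^ 2 + n 1 ^ 2 + n 2 ^ 2 = 1 := by
      have := EuclideanSpace.real_norm_sq_eq n
      rw [hn, Fin.sum_univ_three] at this
      linarith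
    have hn'' : (n 0 : ℂ) ^ 2 + (n 1 : ℂ) ^ 2 + (n 2 : ℂ) ^ 2 = 1 := by
      simpa using congrArg (fun x : ℝ => (x : ℂ)) hn'
    rw [axisMatrix, sl2, Matrix.det_fin_two_of]
    linear_combination (-1 / 4 : ℂ) * hn'' + (n 1 : ℂ) ^ 2 / 4 * Complex.I_sq
  have hsl := eq_sl2_of_trace_eq_zero htr
  rw [← hA', hsl]
  refine hc _ _ _ ?_
  rw [hsl, sl2, Matrix.det_fin_two_of] at hdet
  linear_combination -hdet

/-- The stabilizer of a form. -/
def stabilizer (p : BinaryForm) : Subgroup SU2 where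
  carrier := {g | substitute g p = p}
  one_mem' := linSub_one p
  mul_mem' {g h} hg hh := by
    change linSub (g * h).val p = p
    rw [Submonoid.coe_mul, linSub_mul]
    change substitute h (substitute g p) = p
    rw [hg, hh]
  inv_mem' {g} hg := by
    change linSub (g⁻¹).val p = p
    conv_lhs => rw [← show linSub g.val p = p from hg]
    rw [← linSub_mul, ← Submonoid.coe_mul, mul_inv_cancel]
    exact linSub_one p

theorem IsInvariant.closure_iff {s : Set SU2} {p : BinaryForm} :
    IsInvariant (Subgroup.closure s) p ↔ ∀ g ∈ s, substitute g p = p :=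
  (Subgroup.closure_le (stabilizer p))

theorem monomialIn_isHomogeneous {h : Fin 3 → BinaryForm} {d : Fin 3 → ℕ}
    (hh : ∀ i, (h i).IsHomogeneous (d i)) {N : ℕ} {e : ℕ × ℕ × ℕ} (he : e ∈ solutions d N) :
    (monomialIn h e).IsHomogeneous N := by
  have := (((hh 0).pow e.1).mul ((hh 1).pow e.2.1)).mul ((hh 2).pow e.2.2)
  have hN : d 0 * e.1 + d 1 * e.2.1 + d 2 * e.2.2 = N := by
    rw [← show e.1 * d 0 + e.2.1 * d 1 + e.2.2 * d 2 = N from he]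
    ring
  rwa [hN] at this

theorem monomialIn_isInvariant {h : Fin 3 → BinaryForm} {G : Subgroup SU2}
    (hh : ∀ i, IsInvariant G (h i)) (e : ℕ × ℕ × ℕ) : IsInvariant G (monomialIn h e) := by
  intro g hg
  have := fun i => hh i g hg
  simp only [substitute_eq_linSub] at *
  simp only [monomialIn, map_mul, map_pow, this]

theorem productSpan_le_range {h : Fin 3 → BinaryForm} {d : Fin 3 → ℕ}
    (hh : ∀ i, (h i).IsHomogeneous (d i)) (N : ℕ) :
    productSpan h d N ≤ LinearMap.range (majorana N) := by
  refine Submodule.span_le.2 ?_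
  rintro _ ⟨e, he, rfl⟩
  exact exists_majorana_eq (monomialIn_isHomogeneous hh he)

theorem map_statesOf {h : Fin 3 → BinaryForm} {d : Fin 3 → ℕ}
    (hh : ∀ i, (h i).IsHomogeneous (d i)) (N : ℕ) :
    (statesOf N (productSpan h d N)).map (majorana N) = productSpan h d N := by
  rw [statesOf, Submodule.map_comap_eq, inf_eq_right]
  exact productSpan_le_range hh N

theorem productSpan_isInvariant {h : Fin 3 → BinaryForm} {G : Subgroup SU2}
    (hh : ∀ i, IsInvariant G (h i)) (d : Fin 3 → ℕ) {N : ℕ} {p : BinaryForm}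
    (hp : p ∈ productSpan h d N) : IsInvariant G p := by
  intro g hg
  rw [substitute_eq_linSub]
  induction hp using Submodule.span_induction with
  | mem p hp =>
    obtain ⟨e, _, rfl⟩ := hp
    exact monomialIn_isInvariant hh e g hg
  | zero => exact map_zero _
  | add p q _ _ hp hq => rw [map_add, hp, hq]
  | smul c p _ hp => rw [map_smul, hp]

theorem isAnticoherentSubspace_statesOf {T : PolyhedralType} {G : Subgroup SU2}
    (hG : T.IsOfType G) {h : Fin 3 → BinaryForm} (hh : ∀ i, IsInvariant G (h i)) (d : Fin 3 → ℕ)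
    (N : ℕ) : IsAnticoherentSubspace T.order (statesOf N (productSpan h d N)) :=
  fun _ hψ _ => ⟨T.order, le_rfl, isAnticoherent_of_invariant hG (productSpan_isInvariant hh d hψ)⟩

/-! ### Covariants of binary forms -/

/-- The Hessian covariant. -/
def hessian (p : BinaryForm) : BinaryForm :=
  pderiv 0 (pderiv 0 p) * pderiv 1 (pderiv 1 p) - pderiv 0 (pderiv 1 p) ^ 2

/-- The Jacobian covariant of two forms. -/
def jacobian (p q : BinaryForm) : BinaryForm :=
  pderiv 0 p * pderiv 1 q - pderiv 1 p * pderiv 0 q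

theorem pderiv_one_pderiv_zero (p : BinaryForm) :
    pderiv 1 (pderiv 0 p) = pderiv 0 (pderiv 1 p) := by
  have : ⁅pderiv (R := ℂ) (1 : Fin 2), pderiv (R := ℂ) (0 : Fin 2)⁆ = 0 := by
    refine derivation_ext fun i => ?_
    fin_cases i <;> simp [Derivation.commutator_apply, pderiv_X]
  have h := Derivation.congr_fun this p
  rwa [Derivation.commutator_apply, Derivation.zero_apply, sub_eq_zero] at h

theorem jacobian_linSub {A : Matrix (Fin 2) (Fin 2) ℂ} (hA : A.det = 1) (p q : BinaryForm) :
    jacobian (linSub A p) (linSub A q) = linSub A (jacobian p q) := by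
  rw [Matrix.det_fin_two] at hA
  have hC := congrArg (C : ℂ → BinaryForm) hA
  simp only [C_sub, C_mul, C_1] at hC
  simp only [jacobian, pderiv_linSub, Fin.sum_univ_two, map_sub, map_mul]
  linear_combination (linSub A (pderiv 0 p) * linSub A (pderiv 1 q)
    - linSub A (pderiv 1 p) * linSub A (pderiv 0 q)) * hC

theorem hessian_linSub {A : Matrix (Fin 2) (Fin 2) ℂ} (hA : A.det = 1) (p : BinaryForm) :
    hessian (linSub A p) = linSub A (hessian p) := by
  rw [Matrix.det_fin_two] at hA
  have hC := congrArg (C : ℂ → BinaryForm) hA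
  simp only [C_sub, C_mul, C_1] at hC
  simp only [hessian, pderiv_linSub, Fin.sum_univ_two, map_sub, map_mul, map_add, pderiv_C_mul,
    map_pow, pderiv_one_pderiv_zero]
  linear_combination (linSub A (pderiv 0 (pderiv 0 p)) * linSub A (pderiv 1 (pderiv 1 p))
    - linSub A (pderiv 0 (pderiv 1 p)) ^ 2) *
    (C (A 0 0) * C (A 1 1) - C (A 0 1) * C (A 1 0) + 1) * hC

theorem det_val (g : SU2) : g.val.det = 1 := (Matrix.mem_specialUnitaryGroup_iff.1 g.2).2

theorem hessian_C_mul (c : ℂ) (p : BinaryForm) : hessian (C c * p) = C (c ^ 2) * hessian p := by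
  simp only [hessian, pderiv_C_mul, map_pow]
  ring

theorem jacobian_C_mul (c e : ℂ) (p q : BinaryForm) :
    jacobian (C c * p) (C e * q) = C (c * e) * jacobian p q := by
  simp only [jacobian, pderiv_C_mul, map_mul]
  ring

/-- If a substitution multiplies a form by `χ`, it multiplies the Hessian by `χ²`. -/
theorem substitute_eq_C_mul_of_hessian {g : SU2} {f H : BinaryForm} {c χ : ℂ} (hc : c ≠ 0)
    (hH : hessian f = C c * H) (hf : substitute g f = C χ * f) :
    substitute g H = C (χ ^ 2) * H := by
  rw [substitute_eq_linSub] at *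
  have h := hessian_linSub (det_val g) f
  rw [hf, hessian_C_mul, hH, map_mul, linSub_C, mul_left_comm] at h
  exact (mul_left_cancel₀ ((map_ne_zero_iff _ (C_injective _ _)).2 hc) h).symm

/-- If a substitution multiplies two forms by `χ` and `χ'`, it multiplies their Jacobian by `χ χ'`. -/
theorem substitute_eq_C_mul_of_jacobian {g : SU2} {f H T : BinaryForm} {c χ χ' : ℂ} (hc : c ≠ 0)
    (hT : jacobian f H = C c * T) (hf : substitute g f = C χ * f)
    (hH : substitute g H = C χ' * H) : substitute g T = C (χ * χ') * T := by
  rw [substitute_eq_linSub] at *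
  have h := jacobian_linSub (det_val g) f H
  rw [hf, hH, jacobian_C_mul, hT, map_mul (linSub g.val), linSub_C, mul_left_comm] at h
  exact (mul_left_cancel₀ ((map_ne_zero_iff _ (C_injective _ _)).2 hc) h).symm

/-! ### Klein's forms -/

/-- The vertex form of the octahedron. -/
def octF : BinaryForm := X 0 ^ 5 * X 1 - X 0 * X 1 ^ 5

/-- The form of the face centres of the octahedron. -/
def octW : BinaryForm := X 0 ^ 8 + 14 * X 0 ^ 4 * X 1 ^ 4 + X 1 ^ 8

/-- The form of the edge midpoints of the octahedron. -/
def octT : BinaryForm :=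
  X 0 ^ 12 - 33 * X 0 ^ 8 * X 1 ^ 4 - 33 * X 0 ^ 4 * X 1 ^ 8 + X 1 ^ 12

/-- The vertex form of the icosahedron. -/
def icoF : BinaryForm := X 0 ^ 11 * X 1 + 11 * X 0 ^ 6 * X 1 ^ 6 - X 0 * X 1 ^ 11

/-- The form of the face centres of the icosahedron. -/
def icoH : BinaryForm :=
  -(X 0 ^ 20 + X 1 ^ 20) + 228 * (X 0 ^ 15 * X 1 ^ 5 - X 0 ^ 5 * X 1 ^ 15)
    - 494 * X 0 ^ 10 * X 1 ^ 10

/-- The form of the edge midpoints of the icosahedron. -/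
def icoT : BinaryForm :=
  X 0 ^ 30 + X 1 ^ 30 + 522 * (X 0 ^ 25 * X 1 ^ 5 - X 0 ^ 5 * X 1 ^ 25)
    - 10005 * (X 0 ^ 20 * X 1 ^ 10 + X 0 ^ 10 * X 1 ^ 20)

theorem pderiv_ofNat (i : Fin 2) (n : ℕ) [n.AtLeastTwo] :
    pderiv i (ofNat(n) : BinaryForm) = 0 := by
  rw [← map_ofNat C, pderiv_C]

theorem hessian_octF : hessian octF = C (-25) * octW := by
  simp [hessian, octF, octW, pderiv_X, pderiv_ofNat, map_ofNat]
  ring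

theorem jacobian_octF_octW : jacobian octF octW = C (-8) * octT := by
  simp [jacobian, octF, octW, octT, pderiv_X, pderiv_ofNat, map_ofNat]
  ring

theorem hessian_icoF : hessian icoF = C 121 * icoH := by
  simp [hessian, icoF, icoH, pderiv_X, pderiv_ofNat, map_ofNat]
  ring

theorem jacobian_icoF_icoH : jacobian icoF icoH = C 20 * icoT := by
  simp [jacobian, icoF, icoH, icoT, pderiv_X, pderiv_ofNat, map_ofNat]
  ring

/-- The syzygy between the icosahedral forms. -/
theorem icosahedral_syzygy : icoT ^ 2 + icoH ^ 3 = 1728 * icoF ^ 5 := by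
  rw [icoT, icoH, icoF]
  ring

/-! ### The action of the generators on the vertex forms -/

theorem substitute_diagRot_mono (t : ℝ) (a b : ℕ) :
    substitute (diagRot t) (X 0 ^ a * X 1 ^ b) =
      C (Complex.exp (t * Complex.I) ^ a * Complex.exp (-(t * Complex.I)) ^ b)
        * (X 0 ^ a * X 1 ^ b) := by
  have h' : star (Complex.exp (t * Complex.I)) = Complex.exp (-(t * Complex.I)) := by
    rw [Complex.star_def, ← Complex.exp_conj]
    simp
  rw [substitute_eq_linSub, map_mul, map_pow, map_pow, linSub_X, linSub_X]
  simp only [diagRot, su2, Fin.sum_univ_two, Matrix.of_apply, Matrix.cons_val', star_zero, neg_zero,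
    Matrix.cons_val_zero, Matrix.cons_val_one, Matrix.cons_val_fin_one, map_zero, zero_mul,
    add_zero, zero_add, h', map_mul, map_pow]
  ring

/-- A diagonal rotation by an angle in `(π / 4) ℤ` multiplies the vertex form by a sign. -/
theorem substitute_diagRot_octF {t : ℝ} {χ : ℂ} (hχ : Complex.exp (t * Complex.I) ^ 4 = χ)
    (hχ2 : χ ^ 2 = 1) : substitute (diagRot t) octF = C χ * octF := by
  have h1 := substitute_diagRot_mono t 5 1
  have h2 := substitute_diagRot_mono t 1 5
  have hab : Complex.exp (t * Complex.I) * Complex.exp (-(t * Complex.I)) = 1 := by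
    rw [← Complex.exp_add, add_neg_cancel, Complex.exp_zero]
  have hb : Complex.exp (-(t * Complex.I)) ^ 4 = χ := by
    have : χ * Complex.exp (-(t * Complex.I)) ^ 4 = 1 := by rw [← hχ, ← mul_pow, hab, one_pow]
    linear_combination χ * this - Complex.exp (-(t * Complex.I)) ^ 4 * hχ2
  have c1 : Complex.exp (t * Complex.I) ^ 5 * Complex.exp (-(t * Complex.I)) ^ 1 = χ := by
    linear_combination Complex.exp (t * Complex.I) ^ 4 * hab + hχ
  have c2 : Complex.exp (t * Complex.I) ^ 1 * Complex.exp (-(t * Complex.I)) ^ 5 = χ := by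
    linear_combination Complex.exp (-(t * Complex.I)) ^ 4 * hab + hb
  rw [c1, pow_one] at h1
  rw [c2, pow_one] at h2
  rw [substitute_eq_linSub] at *
  rw [octF, map_sub, h1, h2]
  ring

theorem substitute_diagRot_icoF : substitute (diagRot (6 * Real.pi / 5)) icoF = icoF := by
  set t : ℝ := 6 * Real.pi / 5 with ht
  have h1 := substitute_diagRot_mono t 11 1
  have h2 := substitute_diagRot_mono t 6 6
  have h3 := substitute_diagRot_mono t 1 11
  have hab : Complex.exp (t * Complex.I) * Complex.exp (-(t * Complex.I)) = 1 := by
    rw [← Complex.exp_add, add_neg_cancel, Complex.exp_zero]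
  have ha : Complex.exp (t * Complex.I) ^ 10 = 1 := by
    rw [← Complex.exp_nat_mul, Complex.exp_eq_one_iff]
    refine ⟨6, ?_⟩
    rw [ht]
    push_cast
    ring
  have hb : Complex.exp (-(t * Complex.I)) ^ 10 = 1 := by
    rw [← one_mul (Complex.exp (-(t * Complex.I)) ^ 10)]
    nth_rewrite 1 [← ha]
    rw [← mul_pow, hab, one_pow]
  have c1 : Complex.exp (t * Complex.I) ^ 11 * Complex.exp (-(t * Complex.I)) ^ 1 = 1 := by
    linear_combination Complex.exp (t * Complex.I) ^ 10 * hab + ha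
  have c2 : Complex.exp (t * Complex.I) ^ 6 * Complex.exp (-(t * Complex.I)) ^ 6 = 1 := by
    rw [← mul_pow, hab, one_pow]
  have c3 : Complex.exp (t * Complex.I) ^ 1 * Complex.exp (-(t * Complex.I)) ^ 11 = 1 := by
    linear_combination Complex.exp (-(t * Complex.I)) ^ 10 * hab + hb
  rw [c1, C_1, one_mul, pow_one] at h1
  rw [c2, C_1, one_mul] at h2
  rw [c3, C_1, one_mul, pow_one] at h3
  rw [substitute_eq_linSub] at *
  rw [icoF, mul_assoc, map_sub, map_add, map_mul _ 11, h1, h2, h3, map_ofNat]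

theorem linSub_swapJ : linSub swapJ.val (X 0) = X 1 ∧ linSub swapJ.val (X 1) = -X 0 := by
  constructor <;> simp [linSub_X, swapJ, su2]

theorem substitute_swapJ_octF : substitute swapJ octF = octF := by
  simp only [substitute_eq_linSub, octF, map_sub, map_mul, map_pow, linSub_swapJ]
  ring

theorem substitute_swapJ_icoF : substitute swapJ icoF = icoF := by
  simp only [substitute_eq_linSub, icoF, map_sub, map_add, map_mul, map_pow, linSub_swapJ,
    map_ofNat]
  ring

theorem substitute_rotThree_octF : substitute rotThree octF = octF := by
  set κ : BinaryForm := C ((1 + Complex.I) / 2) with hκ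
  set J : BinaryForm := C Complex.I with hJ
  have h1 : J ^ 4 = 1 := by rw [hJ, ← C_pow, Complex.I_pow_four, C_1]
  have h2 : 8 * κ ^ 6 * J = 1 := by
    have : (8 : ℂ) * ((1 + Complex.I) / 2) ^ 6 * Complex.I = 1 := by
      have hs : ((1 + Complex.I) / 2) ^ 2 = Complex.I / 2 := by
        linear_combination (1 / 4 : ℂ) * Complex.I_sq
      calc (8 : ℂ) * ((1 + Complex.I) / 2) ^ 6 * Complex.I
          = 8 * (((1 + Complex.I) / 2) ^ 2) ^ 3 * Complex.I := by ring
        _ = Complex.I ^ 4 := by rw [hs]; ring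
        _ = 1 := Complex.I_pow_four
    have := congrArg (C : ℂ → BinaryForm) this
    simpa only [C_mul, C_pow, C_1, map_ofNat] using this
  have e0 : linSub rotThree.val (X 0) = κ * (X 0 + X 1) := by
    simp [linSub_X, rotThree, su2, hκ, mul_add]
  have e1 : linSub rotThree.val (X 1) = κ * J * (X 0 - X 1) := by
    have ha : -star ((1 + Complex.I) / 2) = (1 + Complex.I) / 2 * Complex.I := by
      simp
      linear_combination (-1 / 2 : ℂ) * Complex.I_sq
    have hb : star ((1 + Complex.I) / 2) = -((1 + Complex.I) / 2 * Complex.I) := by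
      rw [← ha, neg_neg]
    rw [linSub_X, Fin.sum_univ_two]
    simp only [rotThree, su2, Matrix.of_apply, Matrix.cons_val', Matrix.cons_val_zero,
      Matrix.cons_val_one, Matrix.cons_val_fin_one]
    rw [ha, hb, C_neg, C_mul]
    ring
  -- The image of the vertex form is `κ ^ 6 * i * (z + w) * (z - w) * ((z + w) ^ 4 - (z - w) ^ 4)`.
  simp only [substitute_eq_linSub, octF, map_sub, map_mul, map_pow, e0, e1]
  linear_combination (X 0 ^ 5 * X 1 - X 0 * X 1 ^ 5) * h2
    - κ ^ 6 * J * (X 0 + X 1) * (X 0 - X 1) ^ 5 * h1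

/-- The icosahedral vertex form under the substitution `(z, w) ↦ (w - φ z, z + φ w)`, where `φ` is
a golden ratio. -/
theorem golden_substitution {R : Type*} [CommRing R] (z w F : R) (f2 : F ^ 2 = F + 1) :
    (w - F * z) ^ 11 * (z + F * w) + 11 * (w - F * z) ^ 6 * (z + F * w) ^ 6
        - (w - F * z) * (z + F * w) ^ 11
      = 5 ^ 3 * (8 * F + 5) * (z ^ 11 * w + 11 * z ^ 6 * w ^ 6 - z * w ^ 11) := by
  -- Powers of the golden ratio are reduced to linear expressions in it.
  have f3 : F ^ 3 = 2 * F + 1 := by linear_combination (F + 1) * f2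
  have f4 : F ^ 4 = 3 * F + 2 := by linear_combination F * f3 + 2 * f2
  have f5 : F ^ 5 = 5 * F + 3 := by linear_combination F * f4 + 3 * f2
  have hU : (w - F * z) ^ 5 = w ^ 5 - 5 * F * z * w ^ 4
      + 10 * (F + 1) * z ^ 2 * w ^ 3 - 10 * (2 * F + 1) * z ^ 3 * w ^ 2
      + 5 * (3 * F + 2) * z ^ 4 * w - (5 * F + 3) * z ^ 5 := by
    linear_combination 10 * z ^ 2 * w ^ 3 * f2 - 10 * z ^ 3 * w ^ 2 * f3
      + 5 * z ^ 4 * w * f4 - z ^ 5 * f5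
  have hV : (z + F * w) ^ 5 = z ^ 5 + 5 * F * z ^ 4 * w
      + 10 * (F + 1) * z ^ 3 * w ^ 2 + 10 * (2 * F + 1) * z ^ 2 * w ^ 3
      + 5 * (3 * F + 2) * z * w ^ 4 + (5 * F + 3) * w ^ 5 := by
    linear_combination 10 * z ^ 3 * w ^ 2 * f2 + 10 * z ^ 2 * w ^ 3 * f3
      + 5 * z * w ^ 4 * f4 + w ^ 5 * f5
  have hP : (w - F * z) * (z + F * w) = -F * (z ^ 2 + z * w - w ^ 2) := by
    linear_combination (-z * w) * f2
  have hsplit : ∀ u v : R, u ^ 11 * v + 11 * u ^ 6 * v ^ 6 - u * v ^ 11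
      = u * v * ((u ^ 5) ^ 2 + 11 * u ^ 5 * v ^ 5 - (v ^ 5) ^ 2) := fun u v => by ring
  rw [hsplit, hP, hU, hV]
  linear_combination (25 * z ^ 12 + 225 * z ^ 11 * w + 225 * z ^ 10 * w ^ 2
    - 250 * z ^ 9 * w ^ 3 - 750 * z ^ 8 * w ^ 4 + 150 * z ^ 7 * w ^ 5
    + 1850 * z ^ 6 * w ^ 6 - 150 * z ^ 5 * w ^ 7 - 750 * z ^ 4 * w ^ 8
    + 250 * z ^ 3 * w ^ 9 + 225 * z ^ 2 * w ^ 10 - 225 * z * w ^ 11 + 25 * w ^ 12) * f2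
    + (-25 * z ^ 12 + 400 * z ^ 11 * w - 225 * z ^ 10 * w ^ 2
    + 250 * z ^ 9 * w ^ 3 + 750 * z ^ 8 * w ^ 4 - 150 * z ^ 7 * w ^ 5
    + 5025 * z ^ 6 * w ^ 6 + 150 * z ^ 5 * w ^ 7 + 750 * z ^ 4 * w ^ 8
    - 250 * z ^ 3 * w ^ 9 - 225 * z ^ 2 * w ^ 10 - 400 * z * w ^ 11 - 25 * w ^ 12) * f3

theorem substitute_icosaRot_icoF : substitute icosaRot icoF = icoF := by
  obtain ⟨b, hb, hb5, hQ⟩ := icosaRot_val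
  set φ := Real.goldenRatio with hφ
  have hφ2 : φ ^ 2 = φ + 1 := Real.goldenRatio_sq
  set κ : BinaryForm := C (b * Complex.I) with hκ
  set F : BinaryForm := C (φ : ℂ) with hF
  have f2 : F ^ 2 = F + 1 := by
    have : (φ : ℂ) ^ 2 = φ + 1 := by exact_mod_cast hφ2
    rw [hF, ← C_pow, this, C_add, C_1]
  have hκ12 : κ ^ 12 * (5 ^ 3 * (8 * F + 5)) = 1 := by
    have hr : b ^ 12 * (5 ^ 3 * (8 * φ + 5)) = 1 := by
      have b2 : b ^ 2 = (3 - φ) / 5 := by linear_combination hb5 / 5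
      have b4 : b ^ 4 = (2 - φ) / 5 := by
        linear_combination (b ^ 2 + (3 - φ) / 5) * b2 + hφ2 / 25
      have b12 : b ^ 12 = (13 - 8 * φ) / 125 := by
        rw [show b ^ 12 = (b ^ 4) ^ 3 by ring, b4]
        linear_combination (5 - φ) / 125 * hφ2
      rw [b12]
      linear_combination -64 * hφ2
    have hc : (b * Complex.I) ^ 12 * (5 ^ 3 * (8 * φ + 5)) = 1 := by
      have hI : Complex.I ^ 12 = 1 := by
        rw [show 12 = 4 * 3 by norm_num, pow_mul, Complex.I_pow_four, one_pow]
      rw [mul_pow, hI, mul_one]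
      exact_mod_cast hr
    rw [← C_1, ← hc, hκ, hF]
    simp only [map_mul, map_add, map_pow, map_ofNat]
  have e0 : linSub icosaRot.val (X 0) = κ * (X 1 - F * X 0) := by
    rw [linSub_X, Fin.sum_univ_two, hQ]
    simp only [Matrix.of_apply, Matrix.cons_val', Matrix.cons_val_zero,
      Matrix.cons_val_one, Matrix.cons_val_fin_one, Complex.ofReal_mul, C_mul, C_neg, hκ, hF]
    ring
  have e1 : linSub icosaRot.val (X 1) = κ * (X 0 + F * X 1) := by
    rw [linSub_X, Fin.sum_univ_two, hQ]
    simp only [Matrix.of_apply, Matrix.cons_val', Matrix.cons_val_zero,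
      Matrix.cons_val_one, Matrix.cons_val_fin_one, Complex.ofReal_mul, C_mul, hκ, hF]
    ring
  have hsub : linSub icosaRot.val icoF = κ ^ 12 * ((X 1 - F * X 0) ^ 11 * (X 0 + F * X 1)
      + 11 * (X 1 - F * X 0) ^ 6 * (X 0 + F * X 1) ^ 6
      - (X 1 - F * X 0) * (X 0 + F * X 1) ^ 11) := by
    simp only [icoF, map_sub, map_add, map_mul, map_pow, map_ofNat, e0, e1]
    generalize X 1 - F * X 0 = u
    generalize X 0 + F * X 1 = v
    ring
  rw [substitute_eq_linSub, hsub, golden_substitution _ _ _ f2, ← mul_assoc, hκ12, one_mul]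
  rfl

/-! ### Klein's forms are homogeneous invariants -/

theorem isHomogeneous_mono {a b n : ℕ} (h : a + b = n) :
    (X 0 ^ a * X 1 ^ b : BinaryForm).IsHomogeneous n :=
  h ▸ (isHomogeneous_X_pow 0 a).mul (isHomogeneous_X_pow 1 b)

theorem isHomogeneous_of_eq {p q : BinaryForm} {n : ℕ} (h : q.IsHomogeneous n) (e : p = q) :
    p.IsHomogeneous n := e ▸ h

theorem isHomogeneous_octF : octF.IsHomogeneous 6 := by
  have h := (isHomogeneous_mono (a := 5) (b := 1) (n := 6) rfl).sub
    (isHomogeneous_mono (a := 1) (b := 5) rfl)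
  refine isHomogeneous_of_eq h ?_
  simp [octF]

theorem isHomogeneous_octW : octW.IsHomogeneous 8 := by
  have h := ((isHomogeneous_mono (a := 8) (b := 0) (n := 8) rfl).add
    ((isHomogeneous_mono (a := 4) (b := 4) rfl).C_mul 14)).add
    (isHomogeneous_mono (a := 0) (b := 8) rfl)
  refine isHomogeneous_of_eq h ?_
  simp [octW, map_ofNat, mul_assoc]

theorem isHomogeneous_octT : octT.IsHomogeneous 12 := by
  have h := (((isHomogeneous_mono (a := 12) (b := 0) (n := 12) rfl).sub
    ((isHomogeneous_mono (a := 8) (b := 4) rfl).C_mul 33)).sub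
    ((isHomogeneous_mono (a := 4) (b := 8) rfl).C_mul 33)).add
    (isHomogeneous_mono (a := 0) (b := 12) rfl)
  refine isHomogeneous_of_eq h ?_
  simp [octT, map_ofNat, mul_assoc]

theorem isHomogeneous_icoF : icoF.IsHomogeneous 12 := by
  have h := ((isHomogeneous_mono (a := 11) (b := 1) (n := 12) rfl).add
    ((isHomogeneous_mono (a := 6) (b := 6) rfl).C_mul 11)).sub
    (isHomogeneous_mono (a := 1) (b := 11) rfl)
  refine isHomogeneous_of_eq h ?_
  simp [icoF, map_ofNat, mul_assoc]

theorem isHomogeneous_icoH : icoH.IsHomogeneous 20 := by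
  have h := (((isHomogeneous_mono (a := 20) (b := 0) (n := 20) rfl).add
    (isHomogeneous_mono (a := 0) (b := 20) rfl)).neg.add
    (((isHomogeneous_mono (a := 15) (b := 5) rfl).sub
      (isHomogeneous_mono (a := 5) (b := 15) rfl)).C_mul 228)).sub
    ((isHomogeneous_mono (a := 10) (b := 10) rfl).C_mul 494)
  refine isHomogeneous_of_eq h ?_
  simp [icoH, map_ofNat, mul_assoc]

theorem isHomogeneous_icoT : icoT.IsHomogeneous 30 := by
  have h := (((isHomogeneous_mono (a := 30) (b := 0) (n := 30) rfl).add
    (isHomogeneous_mono (a := 0) (b := 30) rfl)).add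
    (((isHomogeneous_mono (a := 25) (b := 5) rfl).sub
      (isHomogeneous_mono (a := 5) (b := 25) rfl)).C_mul 522)).sub
    (((isHomogeneous_mono (a := 20) (b := 10) rfl).add
      (isHomogeneous_mono (a := 10) (b := 20) rfl)).C_mul 10005)
  refine isHomogeneous_of_eq h ?_
  simp [icoT, map_ofNat]

namespace PolyhedralType

theorem tetrahedral_invariants : tetrahedral.invariants = ![octF, octW, octT] := rfl

theorem octahedral_invariants : octahedral.invariants = ![octW, octF ^ 2, octF * octT] := rfl

theorem icosahedral_invariants : icosahedral.invariants = ![icoF, icoH, icoT] := rfl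

theorem invariants_isHomogeneous (T : PolyhedralType) (i : Fin 3) :
    (T.invariants i).IsHomogeneous (T.degrees i) := by
  cases T with
  | dihedral n hn =>
    fin_cases i
    · exact isHomogeneous_mono rfl
    · have h := ((isHomogeneous_mono (a := 2 * n) (b := 0) (n := 2 * n) rfl).sub
        ((isHomogeneous_mono (a := n) (b := n) (by ring)).C_mul (1 + (-1) ^ n))).add
        (isHomogeneous_mono (a := 0) (b := 2 * n) (by ring))
      refine isHomogeneous_of_eq h ?_
      simp [invariants]
    · have h := (isHomogeneous_mono (a := 2 * n + 1) (b := 1) (n := 2 * n + 2) rfl).sub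
        (isHomogeneous_mono (a := 1) (b := 2 * n + 1) (by ring))
      refine isHomogeneous_of_eq h ?_
      simp [invariants]
  | tetrahedral =>
    rw [tetrahedral_invariants]
    fin_cases i
    exacts [isHomogeneous_octF, isHomogeneous_octW, isHomogeneous_octT]
  | octahedral =>
    rw [octahedral_invariants]
    fin_cases i
    exacts [isHomogeneous_octW, isHomogeneous_octF.pow 2, isHomogeneous_octF.mul isHomogeneous_octT]
  | icosahedral =>
    rw [icosahedral_invariants]
    fin_cases i
    exacts [isHomogeneous_icoF, isHomogeneous_icoH, isHomogeneous_icoT]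

theorem dihedral_invariants_isInvariant (n : ℕ) (hn : 2 ≤ n) (i : Fin 3) :
    IsInvariant (dihedral n hn).group ((dihedral n hn).invariants i) := by
  rw [group, IsInvariant.closure_iff]
  rintro g (rfl | rfl)
  · set t : ℝ := Real.pi / n with ht
    have hn0 : (n : ℂ) ≠ 0 := Nat.cast_ne_zero.2 (by omega)
    have hab : Complex.exp (t * Complex.I) * Complex.exp (-(t * Complex.I)) = 1 := by
      rw [← Complex.exp_add, add_neg_cancel, Complex.exp_zero]
    have ha : Complex.exp (t * Complex.I) ^ (2 * n) = 1 := by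
      rw [← Complex.exp_nat_mul, Complex.exp_eq_one_iff]
      refine ⟨1, ?_⟩
      rw [ht]
      push_cast
      field_simp
    have hb : Complex.exp (-(t * Complex.I)) ^ (2 * n) = 1 := by
      rw [← one_mul (Complex.exp (-(t * Complex.I)) ^ (2 * n))]
      nth_rewrite 1 [← ha]
      rw [← mul_pow, hab, one_pow]
    fin_cases i
    · change substitute _ (X 0 ^ 2 * X 1 ^ 2) = X 0 ^ 2 * X 1 ^ 2
      have c : Complex.exp (t * Complex.I) ^ 2 * Complex.exp (-(t * Complex.I)) ^ 2 = 1 := by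
        rw [← mul_pow, hab, one_pow]
      rw [substitute_diagRot_mono, c, C_1, one_mul]
    · change substitute _ (X 0 ^ (2 * n) - C (1 + (-1) ^ n) * (X 0 ^ n * X 1 ^ n) + X 1 ^ (2 * n))
        = X 0 ^ (2 * n) - C (1 + (-1) ^ n) * (X 0 ^ n * X 1 ^ n) + X 1 ^ (2 * n)
      have h1 := substitute_diagRot_mono t (2 * n) 0
      have h2 := substitute_diagRot_mono t n n
      have h3 := substitute_diagRot_mono t 0 (2 * n)
      have c : Complex.exp (t * Complex.I) ^ n * Complex.exp (-(t * Complex.I)) ^ n = 1 := by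
        rw [← mul_pow, hab, one_pow]
      rw [ha, pow_zero, pow_zero, mul_one, mul_one, C_1, one_mul] at h1
      rw [c, C_1, one_mul] at h2
      rw [hb, pow_zero, pow_zero, one_mul, one_mul, C_1, one_mul] at h3
      rw [substitute_eq_linSub] at *
      rw [map_add, map_sub, map_mul, linSub_C, h1, h2, h3]
    · change substitute _ (X 0 ^ (2 * n + 1) * X 1 - X 0 * X 1 ^ (2 * n + 1))
        = X 0 ^ (2 * n + 1) * X 1 - X 0 * X 1 ^ (2 * n + 1)
      have h1 := substitute_diagRot_mono t (2 * n + 1) 1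
      have h2 := substitute_diagRot_mono t 1 (2 * n + 1)
      have c1 : Complex.exp (t * Complex.I) ^ (2 * n + 1) * Complex.exp (-(t * Complex.I)) ^ 1
          = 1 := by
        rw [pow_succ, ha, one_mul, pow_one, hab]
      have c2 : Complex.exp (t * Complex.I) ^ 1 * Complex.exp (-(t * Complex.I)) ^ (2 * n + 1)
          = 1 := by
        rw [pow_succ _ (2 * n), hb, one_mul, pow_one, hab]
      rw [c1, C_1, one_mul, pow_one] at h1
      rw [c2, C_1, one_mul, pow_one] at h2
      rw [substitute_eq_linSub] at *
      rw [map_sub, h1, h2]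
  · have hsign : ((-1 : BinaryForm) ^ n) ^ 2 = 1 := by rw [← pow_mul, mul_comm, pow_mul]; simp
    fin_cases i
    · change substitute _ (X 0 ^ 2 * X 1 ^ 2) = X 0 ^ 2 * X 1 ^ 2
      simp only [substitute_eq_linSub, map_mul, map_pow, linSub_swapJ]
      ring
    · change substitute _ (X 0 ^ (2 * n) - C (1 + (-1) ^ n) * (X 0 ^ n * X 1 ^ n) + X 1 ^ (2 * n))
        = X 0 ^ (2 * n) - C (1 + (-1) ^ n) * (X 0 ^ n * X 1 ^ n) + X 1 ^ (2 * n)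
      simp only [substitute_eq_linSub, map_sub, map_add, map_mul, map_pow, linSub_swapJ,
        neg_pow (X 0 : BinaryForm), pow_mul (-1 : BinaryForm), neg_one_sq, one_pow, map_one, map_neg]
      linear_combination (-X 0 ^ n * X 1 ^ n) * hsign
    · change substitute _ (X 0 ^ (2 * n + 1) * X 1 - X 0 * X 1 ^ (2 * n + 1))
        = X 0 ^ (2 * n + 1) * X 1 - X 0 * X 1 ^ (2 * n + 1)
      simp only [substitute_eq_linSub, map_sub, map_mul, map_pow, linSub_swapJ,
        neg_pow (X 0 : BinaryForm), pow_succ (-1 : BinaryForm) (2 * n), pow_mul (-1 : BinaryForm),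
        neg_one_sq, one_pow]
      ring

/-- The octahedral forms have the characters `χ`, `χ²` and `χ³`. For the octahedral group `χ` is a
sign, so that only `W`, `f²` and `f T` are invariant. -/
theorem octForms_substitute {g : SU2} {χ : ℂ} (h : substitute g octF = C χ * octF) :
    substitute g octW = C (χ ^ 2) * octW ∧ substitute g octT = C (χ ^ 3) * octT := by
  have hW := substitute_eq_C_mul_of_hessian (by norm_num) hessian_octF h
  refine ⟨hW, ?_⟩
  rw [substitute_eq_C_mul_of_jacobian (by norm_num) jacobian_octF_octW h hW]
  ring_nf

theorem invariants_isInvariant (T : PolyhedralType) (i : Fin 3) :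
    IsInvariant T.group (T.invariants i) := by
  cases T with
  | dihedral n hn => exact dihedral_invariants_isInvariant n hn i
  | tetrahedral =>
    rw [group, IsInvariant.closure_iff]
    have key : ∀ g ∈ ({diagRot (Real.pi / 2), swapJ, rotThree} : Set SU2),
        substitute g octF = C 1 * octF := by
      rintro g (rfl | rfl | rfl)
      · refine substitute_diagRot_octF ?_ (by norm_num)
        rw [← Complex.exp_nat_mul, Complex.exp_eq_one_iff]
        refine ⟨1, ?_⟩
        push_cast
        ring
      · rw [C_1, one_mul, substitute_swapJ_octF]
      · rw [C_1, one_mul, substitute_rotThree_octF]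
    intro g hg
    have hF := key g hg
    obtain ⟨hW, hT⟩ := octForms_substitute hF
    simp only [one_pow, C_1, one_mul] at hF hW hT
    rw [tetrahedral_invariants]
    fin_cases i
    exacts [hF, hW, hT]
  | octahedral =>
    rw [group, IsInvariant.closure_iff]
    have key : ∀ g ∈ ({diagRot (Real.pi / 4), swapJ, rotThree} : Set SU2),
        ∃ χ : ℂ, χ ^ 2 = 1 ∧ substitute g octF = C χ * octF := by
      rintro g (rfl | rfl | rfl)
      · refine ⟨-1, by norm_num, substitute_diagRot_octF ?_ (by norm_num)⟩
        rw [← Complex.exp_nat_mul, ← Complex.exp_pi_mul_I]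
        congr 1
        push_cast
        ring
      · exact ⟨1, by norm_num, by rw [C_1, one_mul, substitute_swapJ_octF]⟩
      · exact ⟨1, by norm_num, by rw [C_1, one_mul, substitute_rotThree_octF]⟩
    intro g hg
    obtain ⟨χ, hχ, hF⟩ := key g hg
    obtain ⟨hW, hT⟩ := octForms_substitute hF
    have hχ3 : χ ^ 3 = χ := by rw [pow_succ, hχ, one_mul]
    have hC : (C χ : BinaryForm) ^ 2 = 1 := by rw [← C_pow, hχ, C_1]
    rw [hχ3] at hT
    rw [octahedral_invariants]
    rw [substitute_eq_linSub] at *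
    fin_cases i
    · change linSub _ octW = octW
      rw [hW, hχ, C_1, one_mul]
    · change linSub _ (octF ^ 2) = octF ^ 2
      rw [map_pow, hF, mul_pow, hC, one_mul]
    · change linSub _ (octF * octT) = octF * octT
      rw [map_mul, hF, hT, mul_mul_mul_comm, ← sq, hC, one_mul]
  | icosahedral =>
    rw [group, IsInvariant.closure_iff]
    have key : ∀ g ∈ ({diagRot (6 * Real.pi / 5), swapJ, icosaRot} : Set SU2),
        substitute g icoF = C 1 * icoF := by
      rintro g (rfl | rfl | rfl) <;> rw [C_1, one_mul]
      exacts [substitute_diagRot_icoF, substitute_swapJ_icoF, substitute_icosaRot_icoF]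
    intro g hg
    have hF := key g hg
    have hH := substitute_eq_C_mul_of_hessian (by norm_num) hessian_icoF hF
    have hT := substitute_eq_C_mul_of_jacobian (by norm_num) jacobian_icoF_icoH hF hH
    simp only [one_pow, C_1, one_mul, mul_one] at hF hH hT
    rw [icosahedral_invariants]
    fin_cases i
    exacts [hF, hH, hT]

end PolyhedralType

/-! ### Independence of products of invariants -/

/-- If `p` vanishes at a point where `A` and `B` do not, then `A * p ^ m` and `B * p ^ n` are
independent for `m < n`: compare the orders of vanishing. -/
theorem eq_zero_of_vanishing_order_lt {p A B : BinaryForm} (P : Fin 2 → ℂ) (hp : eval P p = 0)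
    (hp0 : p ≠ 0) (hA : eval P A ≠ 0) (hB : eval P B ≠ 0) {m n : ℕ} (hmn : m < n) {s t : ℂ}
    (h : C s * (A * p ^ m) + C t * (B * p ^ n) = 0) : s = 0 ∧ t = 0 := by
  obtain ⟨k, rfl⟩ := Nat.exists_eq_add_of_lt hmn
  have h1 : C s * A + C t * B * p ^ (k + 1) = 0 := by
    have : p ^ m * (C s * A + C t * B * p ^ (k + 1)) = 0 := by
      rw [← h]
      ring
    exact (mul_eq_zero.1 this).resolve_left (pow_ne_zero _ hp0)
  have hs : s = 0 := by
    have h2 := congrArg (eval P) h1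
    simp only [map_add, map_mul, eval_C, map_pow, hp, map_zero, pow_succ, mul_zero, add_zero] at h2
    exact (mul_eq_zero.1 h2).resolve_right hA
  refine ⟨hs, ?_⟩
  have hB0 : B ≠ 0 := fun h0 => hB (by rw [h0, map_zero])
  rw [hs, C_0, zero_mul, zero_add] at h1
  have h3 := (mul_eq_zero.1 h1).resolve_right (pow_ne_zero _ hp0)
  exact C_eq_zero.1 ((mul_eq_zero.1 h3).resolve_right hB0)

theorem eq_zero_of_vanishing_order_ne {p A B : BinaryForm} (P : Fin 2 → ℂ) (hp : eval P p = 0)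
    (hp0 : p ≠ 0) (hA : eval P A ≠ 0) (hB : eval P B ≠ 0) {m n : ℕ} (hmn : m ≠ n) {s t : ℂ}
    (h : C s * (A * p ^ m) + C t * (B * p ^ n) = 0) : s = 0 ∧ t = 0 := by
  rcases hmn.lt_or_gt with hlt | hlt
  · exact eq_zero_of_vanishing_order_lt P hp hp0 hA hB hlt h
  · exact (eq_zero_of_vanishing_order_lt P hp hp0 hB hA hlt (by rw [add_comm, h])).symm

/-- Products of three forms with distinct exponents are pairwise independent if the third form has
a zero that is not a zero of the other two, and one of these, `h i`, has a zero that is not a zero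
of the other one, `h j`. -/
theorem linearIndependent_monomialIn {h : Fin 3 → BinaryForm} {d : Fin 3 → ℕ} (hd : ∀ i, 0 < d i)
    {P Q : Fin 2 → ℂ} (hP0 : eval P (h 0) ≠ 0) (hP1 : eval P (h 1) ≠ 0) (hP2 : eval P (h 2) = 0)
    (h2 : h 2 ≠ 0)
    (hQ : (eval Q (h 0) = 0 ∧ eval Q (h 1) ≠ 0) ∨ (eval Q (h 1) = 0 ∧ eval Q (h 0) ≠ 0))
    {N : ℕ} {e e' : ℕ × ℕ × ℕ} (he : e ∈ solutions d N) (he' : e' ∈ solutions d N) (hne : e ≠ e') :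
    LinearIndependent ℂ ![monomialIn h e, monomialIn h e'] := by
  obtain ⟨u, v, w⟩ := e
  obtain ⟨u', v', w'⟩ := e'
  have h0 : h 0 ≠ 0 := fun h0 => hP0 (by rw [h0, map_zero])
  have h1 : h 1 ≠ 0 := fun h0 => hP1 (by rw [h0, map_zero])
  have hdeg : u * d 0 + v * d 1 + w * d 2 = u' * d 0 + v' * d 1 + w' * d 2 :=
    Eq.trans he (Eq.symm he')
  have hnz : ∀ (R : Fin 2 → ℂ) (q : BinaryForm) (m : ℕ), eval R q ≠ 0 → eval R (q ^ m) ≠ 0 :=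
    fun R q m hq => by
      rw [map_pow]
      exact pow_ne_zero _ hq
  rw [LinearIndependent.pair_iff]
  intro s t hst
  simp only [smul_eq_C_mul, monomialIn] at hst
  by_cases hw : w = w'
  · subst hw
    have hst' : C s * (h 0 ^ u * h 1 ^ v) + C t * (h 0 ^ u' * h 1 ^ v') = 0 := by
      have : h 2 ^ w * (C s * (h 0 ^ u * h 1 ^ v) + C t * (h 0 ^ u' * h 1 ^ v')) = 0 := by
        rw [← hst]
        ring
      exact (mul_eq_zero.1 this).resolve_left (pow_ne_zero _ h2)
    have hu : u ≠ u' := by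
      rintro rfl
      have : v * d 1 = v' * d 1 := by omega
      exact hne (by rw [Nat.eq_of_mul_eq_mul_right (hd 1) this])
    have hv : v ≠ v' := by
      rintro rfl
      have : u * d 0 = u' * d 0 := by omega
      exact hne (by rw [Nat.eq_of_mul_eq_mul_right (hd 0) this])
    rcases hQ with ⟨ha, hb⟩ | ⟨ha, hb⟩
    · refine eq_zero_of_vanishing_order_ne Q ha h0 (hnz Q _ v hb) (hnz Q _ v' hb) hu ?_
      rw [← hst']
      ring
    · exact eq_zero_of_vanishing_order_ne Q ha h1 (hnz Q _ u hb) (hnz Q _ u' hb) hv hst'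
  · refine eq_zero_of_vanishing_order_ne P hP2 h2 (A := h 0 ^ u * h 1 ^ v)
      (B := h 0 ^ u' * h 1 ^ v') ?_ ?_ hw hst
    · rw [map_mul]
      exact mul_ne_zero (hnz P _ u hP0) (hnz P _ v hP1)
    · rw [map_mul]
      exact mul_ne_zero (hnz P _ u' hP0) (hnz P _ v' hP1)

namespace PolyhedralType

theorem degrees_pos (T : PolyhedralType) (i : Fin 3) : 0 < T.degrees i := by
  cases T <;> fin_cases i <;> simp [degrees]
  omega

/-- A zero of the form of the edge midpoints of the octahedron. -/
theorem exists_octT_zero : ∃ P : Fin 2 → ℂ,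
    eval P octT = 0 ∧ eval P octW ≠ 0 ∧ eval P octF ≠ 0 := by
  obtain ⟨ζ, hζ⟩ := IsAlgClosed.exists_pow_nat_eq (-1 : ℂ) (n := 4) (by norm_num)
  have hζ0 : ζ ≠ 0 := by
    rintro rfl
    norm_num at hζ
  refine ⟨![ζ, 1], ?_, ?_, ?_⟩
  · simp [octT]
    linear_combination (ζ ^ 8 - 34 * ζ ^ 4 + 1) * hζ
  · have : eval ![ζ, 1] octW = -12 := by
      simp [octW]
      linear_combination (ζ ^ 4 + 13) * hζ
    rw [this]
    norm_num
  · have : eval ![ζ, 1] octF = -2 * ζ := by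
      simp [octF]
      linear_combination ζ * hζ
    rw [this]
    exact mul_ne_zero (by norm_num) hζ0

theorem linearIndependent_dihedral (n : ℕ) (hn : 2 ≤ n) {N : ℕ} {e e' : ℕ × ℕ × ℕ}
    (he : e ∈ solutions (dihedral n hn).degrees N)
    (he' : e' ∈ solutions (dihedral n hn).degrees N) (hne : e ≠ e') :
    LinearIndependent ℂ ![monomialIn (dihedral n hn).invariants e,
      monomialIn (dihedral n hn).invariants e'] := by
  -- The point `(1, η)` with `η^n = -(-1)^n` is a zero of `h₃` only.
  obtain ⟨η, hη⟩ := IsAlgClosed.exists_pow_nat_eq (-(-1) ^ n : ℂ) (n := n) (by omega)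
  have hs : ((-1 : ℂ) ^ n) ^ 2 = 1 := by rw [← pow_mul, mul_comm, pow_mul]; simp
  have hη2 : (η ^ n) ^ 2 = 1 := by rw [hη, neg_sq, hs]
  have hη0 : η ≠ 0 := by
    rintro rfl
    rw [zero_pow (by omega)] at hη2
    norm_num at hη2
  refine linearIndependent_monomialIn (degrees_pos _) (P := ![1, η]) (Q := ![1, 0])
    ?_ ?_ ?_ ?_ (Or.inl ⟨?_, ?_⟩) he he' hne
  · simp [invariants, hη0]
  · have : eval ![1, η] ((dihedral n hn).invariants 1) = 3 + (-1) ^ n := by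
      simp [invariants]
      rw [mul_comm 2 n, pow_mul, hη]
      linear_combination 2 * hs
    rw [this]
    rcases neg_one_pow_eq_or ℂ n with h | h <;> rw [h] <;> norm_num
  · simp [invariants]
    rw [pow_succ, mul_comm 2 n, pow_mul, hη2]
    ring
  · intro h0
    have h1 := congrArg (eval ![1, 2]) h0
    simp [invariants, pow_succ] at h1
    have h2 : ((2 : ℂ) ^ (2 * n)) = ((2 ^ (2 * n) : ℕ) : ℂ) := by push_cast; rfl
    have h3 : (2 : ℂ) ^ (2 * n) = 1 := by linear_combination (-1 / 2 : ℂ) * h1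
    rw [h2] at h3
    have h4 : 2 ^ (2 * n) = 1 := by exact_mod_cast h3
    exact absurd h4 (Nat.one_lt_two_pow (by omega)).ne'
  · simp [invariants]
  · have hn0 : n ≠ 0 := by omega
    simp [invariants, hn0]

theorem linearIndependent_tetrahedral {N : ℕ} {e e' : ℕ × ℕ × ℕ}
    (he : e ∈ solutions tetrahedral.degrees N)
    (he' : e' ∈ solutions tetrahedral.degrees N) (hne : e ≠ e') :
    LinearIndependent ℂ ![monomialIn tetrahedral.invariants e,
      monomialIn tetrahedral.invariants e'] := by
  rw [tetrahedral_invariants]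
  obtain ⟨P, hT, hW, hF⟩ := exists_octT_zero
  refine linearIndependent_monomialIn (degrees_pos tetrahedral) (P := P) (Q := ![1, 0])
    ?_ ?_ ?_ ?_ (Or.inl ⟨?_, ?_⟩) he he' hne
  · simpa using hF
  · simpa using hW
  · simpa using hT
  · intro h0
    have h1 := congrArg (eval ![1, 0]) h0
    simp [octT] at h1
  · simp [octF]
  · simp [octW]

theorem linearIndependent_octahedral {N : ℕ} {e e' : ℕ × ℕ × ℕ}
    (he : e ∈ solutions octahedral.degrees N)
    (he' : e' ∈ solutions octahedral.degrees N) (hne : e ≠ e') :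
    LinearIndependent ℂ ![monomialIn octahedral.invariants e,
      monomialIn octahedral.invariants e'] := by
  rw [octahedral_invariants]
  obtain ⟨P, hT, hW, hF⟩ := exists_octT_zero
  refine linearIndependent_monomialIn (degrees_pos octahedral) (P := P) (Q := ![1, 0])
    ?_ ?_ ?_ ?_ (Or.inr ⟨?_, ?_⟩) he he' hne
  · simpa using hW
  · simp [hF]
  · simp [hT]
  · refine mul_ne_zero (fun h0 => hF (by rw [h0, map_zero])) fun h0 => ?_
    have h1 := congrArg (eval ![1, 0]) h0
    simp [octT] at h1
  · simp [octF]
  · simp [octW]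

theorem linearIndependent_icosahedral {N : ℕ} {e e' : ℕ × ℕ × ℕ}
    (he : e ∈ solutions icosahedral.degrees N)
    (he' : e' ∈ solutions icosahedral.degrees N) (hne : e ≠ e') :
    LinearIndependent ℂ ![monomialIn icosahedral.invariants e,
      monomialIn icosahedral.invariants e'] := by
  rw [icosahedral_invariants]
  -- The point `(i, 1)` is a zero of the form of the edge midpoints only.
  refine linearIndependent_monomialIn (degrees_pos icosahedral) (P := ![Complex.I, 1])
    (Q := ![1, 0]) ?_ ?_ ?_ ?_ (Or.inl ⟨?_, ?_⟩) he he' hne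
  · have : eval ![Complex.I, 1] icoF = -11 - 2 * Complex.I := by
      simp [icoF]
      ring
    intro h0
    rw [show (![icoF, icoH, icoT] 0) = icoF from rfl, this] at h0
    have := congrArg Complex.re h0
    norm_num at this
  · have : eval ![Complex.I, 1] icoH = 492 - 456 * Complex.I := by
      simp [icoH]
      ring
    intro h0
    rw [show (![icoF, icoH, icoT] 1) = icoH from rfl, this] at h0
    have := congrArg Complex.re h0
    norm_num at this
  · simp [icoT]
  · intro h0
    have h1 := congrArg (eval ![1, 0]) h0
    simp [icoT] at h1
  · simp [icoF]
  · simp [icoH]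

theorem linearIndependent_invariants (T : PolyhedralType) {N : ℕ} {e e' : ℕ × ℕ × ℕ}
    (he : e ∈ solutions T.degrees N) (he' : e' ∈ solutions T.degrees N) (hne : e ≠ e') :
    LinearIndependent ℂ ![monomialIn T.invariants e, monomialIn T.invariants e'] := by
  cases T with
  | dihedral n hn => exact linearIndependent_dihedral n hn he he' hne
  | tetrahedral => exact linearIndependent_tetrahedral he he' hne
  | octahedral => exact linearIndependent_octahedral he he' hne
  | icosahedral => exact linearIndependent_icosahedral he he' hne

end PolyhedralType

/-! ### Dimensions -/

theorem solutions_finite {d : Fin 3 → ℕ} (hd : ∀ i, 0 < d i) (N : ℕ) : (solutions d N).Finite := by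
  refine (Set.finite_Iic ((N, N, N) : ℕ × ℕ × ℕ)).subset ?_
  rintro ⟨u, v, w⟩ he
  have he' : u * d 0 + v * d 1 + w * d 2 = N := he
  have h0 := Nat.le_mul_of_pos_right u (hd 0)
  have h1 := Nat.le_mul_of_pos_right v (hd 1)
  have h2 := Nat.le_mul_of_pos_right w (hd 2)
  exact ⟨by simp only; omega, by simp only; omega, by simp only; omega⟩

namespace PolyhedralType

theorem map_subspace (T : PolyhedralType) (N : ℕ) :
    (T.subspace N).map (majorana N) = productSpan T.invariants T.degrees N :=
  map_statesOf T.invariants_isHomogeneous N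

theorem isOfType_group (T : PolyhedralType) : T.IsOfType T.group :=
  ⟨1, by rw [map_one]; exact (Subgroup.map_id _).symm⟩

theorem isAnticoherentSubspace_subspace (T : PolyhedralType) (N : ℕ) :
    IsAnticoherentSubspace T.order (T.subspace N) :=
  isAnticoherentSubspace_statesOf T.isOfType_group T.invariants_isInvariant _ _

theorem finrank_subspace (T : PolyhedralType) (N : ℕ) :
    Module.finrank ℂ (T.subspace N)
      = Module.finrank ℂ (productSpan T.invariants T.degrees N) := by
  rw [← T.map_subspace N]
  exact (Submodule.equivMapOfInjective _ (majorana_injective N) _).finrank_eq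

theorem finrank_subspace_le (T : PolyhedralType) (N : ℕ) :
    Module.finrank ℂ (T.subspace N) ≤ (solutions T.degrees N).ncard := by
  have hfin := solutions_finite T.degrees_pos N
  rw [finrank_subspace, productSpan]
  have himg : (monomialIn T.invariants '' solutions T.degrees N).Finite := hfin.image _
  calc Module.finrank ℂ (Submodule.span ℂ (monomialIn T.invariants '' solutions T.degrees N))
      = Module.finrank ℂ (Submodule.span ℂ (himg.toFinset : Set BinaryForm)) := by
        rw [himg.coe_toFinset]
    _ ≤ himg.toFinset.card := finrank_span_finset_le_card _
    _ = (monomialIn T.invariants '' solutions T.degrees N).ncard :=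
        (Set.ncard_eq_toFinset_card _ himg).symm
    _ ≤ (solutions T.degrees N).ncard := Set.ncard_image_le hfin

theorem two_le_finrank_subspace (T : PolyhedralType) {N : ℕ} {e e' : ℕ × ℕ × ℕ}
    (he : e ∈ solutions T.degrees N) (he' : e' ∈ solutions T.degrees N) (hne : e ≠ e') :
    2 ≤ Module.finrank ℂ (T.subspace N) := by
  rw [finrank_subspace]
  have hli := T.linearIndependent_invariants he he' hne
  have hfin : FiniteDimensional ℂ (productSpan T.invariants T.degrees N) :=
    FiniteDimensional.span_of_finite ℂ ((solutions_finite T.degrees_pos N).image _)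
  have hcard := finrank_span_eq_card hli
  rw [Fintype.card_fin] at hcard
  refine hcard.symm.le.trans ?_
  refine Submodule.finrank_mono (Submodule.span_le.2 ?_)
  rintro _ ⟨i, rfl⟩
  fin_cases i
  · exact Submodule.subset_span ⟨e, he, rfl⟩
  · exact Submodule.subset_span ⟨e', he', rfl⟩

/-- If `12 u + 20 v + 30 w = N` has only the solutions obtained from those of degree sixty by a
shift of `u`, the syzygy makes the icosahedral subspace at most two-dimensional. -/
theorem finrank_icosahedral_le_two {N j : ℕ} (h : ∀ u v w : ℕ, u * 12 + v * 20 + w * 30 = N →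
    (u = j + 5 ∧ v = 0 ∧ w = 0) ∨ (u = j ∧ v = 3 ∧ w = 0) ∨ (u = j ∧ v = 0 ∧ w = 2)) :
    Module.finrank ℂ (icosahedral.subspace N) ≤ 2 := by
  classical
  rw [finrank_subspace, productSpan, icosahedral_invariants]
  have hle : Submodule.span ℂ (monomialIn ![icoF, icoH, icoT] '' solutions icosahedral.degrees N)
      ≤ Submodule.span ℂ ((({icoF ^ j * icoF ^ 5, icoF ^ j * icoH ^ 3} : Finset BinaryForm)) :
        Set BinaryForm) := by
    rw [Submodule.span_le]
    rintro _ ⟨⟨u, v, w⟩, he, rfl⟩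
    have h1 : icoF ^ j * icoF ^ 5 ∈ Submodule.span ℂ
        ((({icoF ^ j * icoF ^ 5, icoF ^ j * icoH ^ 3} : Finset BinaryForm)) : Set BinaryForm) :=
      Submodule.subset_span (by simp)
    have h2 : icoF ^ j * icoH ^ 3 ∈ Submodule.span ℂ
        ((({icoF ^ j * icoF ^ 5, icoF ^ j * icoH ^ 3} : Finset BinaryForm)) : Set BinaryForm) :=
      Submodule.subset_span (by simp)
    have hmon : monomialIn ![icoF, icoH, icoT] (u, v, w) = icoF ^ u * icoH ^ v * icoT ^ w := rfl
    rw [hmon]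
    rcases h u v w he with ⟨rfl, rfl, rfl⟩ | ⟨rfl, rfl, rfl⟩ | ⟨rfl, rfl, rfl⟩
    · simpa [pow_add] using h1
    · simpa using h2
    · have hsyz : icoF ^ u * icoH ^ 0 * icoT ^ 2
          = (1728 : ℂ) • (icoF ^ u * icoF ^ 5) - icoF ^ u * icoH ^ 3 := by
        rw [smul_eq_C_mul, map_ofNat]
        linear_combination icoF ^ u * icosahedral_syzygy
      rw [hsyz]
      exact Submodule.sub_mem _ (Submodule.smul_mem _ _ h1) h2
  refine (Submodule.finrank_mono hle).trans ?_
  exact (finrank_span_finset_le_card _).trans Finset.card_le_two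

theorem finrank_icosahedral_sixty : Module.finrank ℂ (icosahedral.subspace (2 * 30)) = 2 := by
  refine le_antisymm (finrank_icosahedral_le_two (j := 0) fun u v w h => ?_) ?_
  · have hv : v ≤ 3 := by omega
    have hw : w ≤ 2 := by omega
    interval_cases v <;> interval_cases w <;> omega
  · exact icosahedral.two_le_finrank_subspace (e := (5, 0, 0)) (e' := (0, 3, 0)) rfl rfl (by simp)

theorem finrank_icosahedral_seventy_two :
    Module.finrank ℂ (icosahedral.subspace (2 * 36)) = 2 := by
  refine le_antisymm (finrank_icosahedral_le_two (j := 1) fun u v w h => ?_) ?_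
  · have hv : v ≤ 3 := by omega
    have hw : w ≤ 2 := by omega
    interval_cases v <;> interval_cases w <;> omega
  · exact icosahedral.two_le_finrank_subspace (e := (6, 0, 0)) (e' := (1, 3, 0)) rfl rfl (by simp)

theorem two_le_finrank_dihedral {s : ℕ} (h2 : 2 ≤ s) (h3 : s ≠ 3) :
    2 ≤ Module.finrank ℂ ((dihedral 2 le_rfl).subspace (2 * s)) := by
  have hsol : ∀ u v w : ℕ, u * 4 + v * 4 + w * 6 = 2 * s →
      (u, v, w) ∈ solutions (dihedral 2 le_rfl).degrees (2 * s) := fun u v w h => h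
  rcases Nat.even_or_odd' s with ⟨m, rfl | rfl⟩
  · refine two_le_finrank_subspace _ (hsol m 0 0 (by omega)) (hsol 0 m 0 (by omega)) ?_
    simp
    omega
  · refine two_le_finrank_subspace _ (hsol (m - 1) 0 1 (by omega)) (hsol 0 (m - 1) 1 (by omega)) ?_
    simp
    omega

theorem two_le_finrank_tetrahedral {s : ℕ} (hs : s = 6 ∨ (Even s ∧ 10 ≤ s)) :
    2 ≤ Module.finrank ℂ (tetrahedral.subspace (2 * s)) := by
  have hsol : ∀ u v w : ℕ, u * 6 + v * 8 + w * 12 = 2 * s →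
      (u, v, w) ∈ solutions tetrahedral.degrees (2 * s) := fun u v w h => h
  -- The two solutions differ by the exchange of `h₁²` for `h₃`.
  obtain ⟨u, v, h⟩ : ∃ u v : ℕ, s = 6 + 3 * u + 4 * v := by
    rcases hs with rfl | ⟨⟨m, rfl⟩, h10⟩
    · exact ⟨0, 0, rfl⟩
    · rcases Nat.even_or_odd' m with ⟨l, rfl | rfl⟩
      · exact ⟨2, l - 3, by omega⟩
      · exact ⟨0, l - 1, by omega⟩
  exact two_le_finrank_subspace _ (hsol (u + 2) v 0 (by omega)) (hsol u v 1 (by omega)) (by simp)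

theorem two_le_finrank_octahedral {s : ℕ}
    (hs : s ∈ ({12, 16, 18, 20, 21, 22} : Set ℕ) ∨ 24 ≤ s) :
    2 ≤ Module.finrank ℂ (octahedral.subspace (2 * s)) := by
  have hsol : ∀ u v w : ℕ, u * 8 + v * 12 + w * 18 = 2 * s →
      (u, v, w) ∈ solutions octahedral.degrees (2 * s) := fun u v w h => h
  -- The two solutions differ by the exchange of `h₁³` for `h₂²`.
  obtain ⟨u, v, w, h⟩ : ∃ u v w : ℕ, s = 12 + 4 * u + 6 * v + 9 * w := by
    rcases hs with hs | hs
    · simp only [Set.mem_insert_iff, Set.mem_singleton_iff] at hs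
      rcases hs with rfl | rfl | rfl | rfl | rfl | rfl
      exacts [⟨0, 0, 0, rfl⟩, ⟨1, 0, 0, rfl⟩, ⟨0, 1, 0, rfl⟩, ⟨2, 0, 0, rfl⟩, ⟨0, 0, 1, rfl⟩,
        ⟨1, 1, 0, rfl⟩]
    · have h4 : s % 4 < 4 := Nat.mod_lt _ (by norm_num)
      have hdiv := Nat.div_add_mod s 4
      interval_cases hr : s % 4
      · exact ⟨s / 4 - 3, 0, 0, by omega⟩
      · exact ⟨s / 4 - 5, 0, 1, by omega⟩
      · exact ⟨s / 4 - 4, 1, 0, by omega⟩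
      · exact ⟨s / 4 - 6, 1, 1, by omega⟩
  exact two_le_finrank_subspace _ (hsol (u + 3) v w (by omega)) (hsol u (v + 2) w (by omega))
    (by simp)

theorem two_le_finrank_icosahedral (a b c : ℕ) :
    2 ≤ Module.finrank ℂ (icosahedral.subspace (2 * (30 + 6 * a + 10 * b + 15 * c))) := by
  have hsol : ∀ u v w : ℕ, u * 12 + v * 20 + w * 30 = 2 * (30 + 6 * a + 10 * b + 15 * c) →
      (u, v, w) ∈ solutions icosahedral.degrees (2 * (30 + 6 * a + 10 * b + 15 * c)) :=
    fun u v w h => h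
  exact two_le_finrank_subspace _ (hsol (a + 5) b c (by ring)) (hsol a (b + 3) c (by ring))
    (by simp)

/-- In degree twelve the tetrahedral products are `h₁²` and `h₃`. -/
theorem productSpan_tetrahedral_twelve :
    productSpan tetrahedral.invariants tetrahedral.degrees 12
      = Submodule.span ℂ {tetrahedral.invariants 0 ^ 2, tetrahedral.invariants 2} := by
  have hsol : solutions tetrahedral.degrees 12 = {(2, 0, 0), (0, 0, 1)} := by
    ext ⟨u, v, w⟩
    have : (u, v, w) ∈ solutions tetrahedral.degrees 12 ↔ u * 6 + v * 8 + w * 12 = 12 := Iff.rfl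
    rw [this]
    simp only [Set.mem_insert_iff, Set.mem_singleton_iff, Prod.mk.injEq]
    omega
  rw [productSpan, hsol, Set.image_pair]
  simp [monomialIn]

/-- The basis of the tetrahedral subspace of spin six given by the forms `h₁²` and `h₃`. -/
theorem exists_tetrahedral_basis : ∃ ψ₁ ψ₂ : State 12,
    (∀ ψ, majorana 12 ψ = X 0 ^ 10 * X 1 ^ 2 - 2 * X 0 ^ 6 * X 1 ^ 6 + X 0 ^ 2 * X 1 ^ 10
      ↔ ψ = ψ₁) ∧
    (∀ ψ, majorana 12 ψ
        = X 0 ^ 12 - 33 * X 0 ^ 8 * X 1 ^ 4 - 33 * X 0 ^ 4 * X 1 ^ 8 + X 1 ^ 12 ↔ ψ = ψ₂) ∧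
    majorana 12 ψ₁ = tetrahedral.invariants 0 ^ 2 ∧
    majorana 12 ψ₂ = tetrahedral.invariants 2 ∧
    Submodule.span ℂ {ψ₁, ψ₂} = tetrahedral.subspace 12 ∧
    Module.finrank ℂ (Submodule.span ℂ {ψ₁, ψ₂}) = 2 ∧
    IsAnticoherentSubspace 2 (Submodule.span ℂ {ψ₁, ψ₂}) := by
  obtain ⟨ψ₁, h₁⟩ : ∃ ψ : State 12, majorana 12 ψ = tetrahedral.invariants 0 ^ 2 :=
    exists_majorana_eq ((tetrahedral.invariants_isHomogeneous 0).pow 2)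
  obtain ⟨ψ₂, h₂⟩ : ∃ ψ : State 12, majorana 12 ψ = tetrahedral.invariants 2 :=
    exists_majorana_eq (tetrahedral.invariants_isHomogeneous 2)
  have hspan : Submodule.span ℂ {ψ₁, ψ₂} = tetrahedral.subspace 12 := by
    rw [subspace, statesOf, productSpan_tetrahedral_twelve, ← h₁, ← h₂, ← Set.image_pair,
      ← Submodule.map_span, Submodule.comap_map_eq_of_injective (majorana_injective 12)]
  have e₁ : tetrahedral.invariants 0 ^ 2
      = X 0 ^ 10 * X 1 ^ 2 - 2 * X 0 ^ 6 * X 1 ^ 6 + X 0 ^ 2 * X 1 ^ 10 := by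
    rw [tetrahedral_invariants]
    change octF ^ 2 = _
    rw [octF]
    ring
  have e₂ : tetrahedral.invariants 2
      = X 0 ^ 12 - 33 * X 0 ^ 8 * X 1 ^ 4 - 33 * X 0 ^ 4 * X 1 ^ 8 + X 1 ^ 12 := rfl
  refine ⟨ψ₁, ψ₂, fun ψ => ?_, fun ψ => ?_, h₁, h₂, hspan, ?_, ?_⟩
  · rw [← e₁, ← h₁]
    exact (majorana_injective 12).eq_iff
  · rw [← e₂, ← h₂]
    exact (majorana_injective 12).eq_iff
  · refine le_antisymm ?_ ?_
    · classical
      have h : Module.finrank ℂ (Submodule.span ℂ (({ψ₁, ψ₂} : Finset (State 12)) : Set (State 12)))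
          ≤ 2 := (finrank_span_finset_le_card _).trans Finset.card_le_two
      rwa [Finset.coe_pair] at h
    · rw [hspan]
      exact two_le_finrank_tetrahedral (s := 6) (Or.inl rfl)
  · rw [hspan]
    exact tetrahedral.isAnticoherentSubspace_subspace 12

end PolyhedralType

end

end Spin

theorem mainTheorem6 :
    -- products of homogeneous invariants of a binary polyhedral group span an anticoherent subspace
    (∀ (T : Spin.PolyhedralType) (G : Subgroup Spin.SU2), T.IsOfType G →
      ∀ (h : Fin 3 → Spin.BinaryForm) (d : Fin 3 → ℕ),
        (∀ i, (h i).IsHomogeneous (d i)) → (∀ i, Spin.IsInvariant G (h i)) →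
        ∀ N : ℕ,
          (Spin.statesOf N (Spin.productSpan h d N)).map (Spin.majorana N)
              = Spin.productSpan h d N ∧
            Spin.IsAnticoherentSubspace T.order (Spin.statesOf N (Spin.productSpan h d N))) ∧
    -- Klein's forms are such invariants; the states they give
    (∀ T : Spin.PolyhedralType,
      (∀ i, (T.invariants i).IsHomogeneous (T.degrees i)) ∧
      (∀ i, Spin.IsInvariant T.group (T.invariants i)) ∧
      ∀ N : ℕ,
        (T.subspace N).map (Spin.majorana N) = Spin.productSpan T.invariants T.degrees N ∧
        Spin.IsAnticoherentSubspace T.order (T.subspace N) ∧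
        (Spin.solutions T.degrees N).Finite ∧
        Module.finrank ℂ (T.subspace N) ≤ (Spin.solutions T.degrees N).ncard ∧
        ∀ e ∈ Spin.solutions T.degrees N, ∀ e' ∈ Spin.solutions T.degrees N, e ≠ e' →
          LinearIndependent ℂ
            ![Spin.monomialIn T.invariants e, Spin.monomialIn T.invariants e']) ∧
    -- binary dihedral group of order eight
    (∀ s : ℕ, 2 ≤ s → s ≠ 3 →
      Spin.IsAnticoherentSubspace 1
          ((Spin.PolyhedralType.dihedral 2 le_rfl).subspace (2 * s)) ∧
        2 ≤ Module.finrank ℂ ((Spin.PolyhedralType.dihedral 2 le_rfl).subspace (2 * s))) ∧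
    -- binary tetrahedral group
    (∀ s : ℕ, s = 6 ∨ (Even s ∧ 10 ≤ s) →
      Spin.IsAnticoherentSubspace 2 (Spin.PolyhedralType.tetrahedral.subspace (2 * s)) ∧
        2 ≤ Module.finrank ℂ (Spin.PolyhedralType.tetrahedral.subspace (2 * s))) ∧
    -- binary octahedral group
    (∀ s : ℕ, s ∈ ({12, 16, 18, 20, 21, 22} : Set ℕ) ∨ 24 ≤ s →
      Spin.IsAnticoherentSubspace 3 (Spin.PolyhedralType.octahedral.subspace (2 * s)) ∧
        2 ≤ Module.finrank ℂ (Spin.PolyhedralType.octahedral.subspace (2 * s))) ∧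
    -- binary icosahedral group
    (Spin.IsAnticoherentSubspace 5 (Spin.PolyhedralType.icosahedral.subspace (2 * 30)) ∧
      Module.finrank ℂ (Spin.PolyhedralType.icosahedral.subspace (2 * 30)) = 2) ∧
    (∃ s : ℕ, 30 < s ∧
      Spin.IsAnticoherentSubspace 5 (Spin.PolyhedralType.icosahedral.subspace (2 * s)) ∧
        Module.finrank ℂ (Spin.PolyhedralType.icosahedral.subspace (2 * s)) = 2) ∧
    (∀ a b c : ℕ,
      Spin.IsAnticoherentSubspace 5
          (Spin.PolyhedralType.icosahedral.subspace (2 * (30 + 6 * a + 10 * b + 15 * c))) ∧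
        2 ≤ Module.finrank ℂ
          (Spin.PolyhedralType.icosahedral.subspace (2 * (30 + 6 * a + 10 * b + 15 * c)))) ∧
    -- the explicit basis for spin six and the binary tetrahedral group
    (∃ ψ₁ ψ₂ : Spin.State 12,
      (∀ ψ, Spin.majorana 12 ψ
          = MvPolynomial.X 0 ^ 10 * MvPolynomial.X 1 ^ 2
            - 2 * MvPolynomial.X 0 ^ 6 * MvPolynomial.X 1 ^ 6
            + MvPolynomial.X 0 ^ 2 * MvPolynomial.X 1 ^ 10 ↔ ψ = ψ₁) ∧
      (∀ ψ, Spin.majorana 12 ψ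
          = MvPolynomial.X 0 ^ 12 - 33 * MvPolynomial.X 0 ^ 8 * MvPolynomial.X 1 ^ 4
            - 33 * MvPolynomial.X 0 ^ 4 * MvPolynomial.X 1 ^ 8
            + MvPolynomial.X 1 ^ 12 ↔ ψ = ψ₂) ∧
      Spin.majorana 12 ψ₁ = Spin.PolyhedralType.tetrahedral.invariants 0 ^ 2 ∧
      Spin.majorana 12 ψ₂ = Spin.PolyhedralType.tetrahedral.invariants 2 ∧
      Submodule.span ℂ {ψ₁, ψ₂} = Spin.PolyhedralType.tetrahedral.subspace 12 ∧
      Module.finrank ℂ (Submodule.span ℂ {ψ₁, ψ₂}) = 2 ∧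
      Spin.IsAnticoherentSubspace 2 (Submodule.span ℂ {ψ₁, ψ₂})) := by
  refine ⟨fun T G hG h d hh hinv N => ⟨Spin.map_statesOf hh N,
      Spin.isAnticoherentSubspace_statesOf hG hinv d N⟩,
    fun T => ⟨T.invariants_isHomogeneous, T.invariants_isInvariant, fun N =>
      ⟨T.map_subspace N, T.isAnticoherentSubspace_subspace N,
        Spin.solutions_finite T.degrees_pos N, T.finrank_subspace_le N,
        fun _ he _ he' hne => T.linearIndependent_invariants he he' hne⟩⟩,
    fun s h2 h3 => ⟨Spin.PolyhedralType.isAnticoherentSubspace_subspace _ _,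
      Spin.PolyhedralType.two_le_finrank_dihedral h2 h3⟩,
    fun s hs => ⟨Spin.PolyhedralType.isAnticoherentSubspace_subspace _ _,
      Spin.PolyhedralType.two_le_finrank_tetrahedral hs⟩,
    fun s hs => ⟨Spin.PolyhedralType.isAnticoherentSubspace_subspace _ _,
      Spin.PolyhedralType.two_le_finrank_octahedral hs⟩,
    ⟨Spin.PolyhedralType.isAnticoherentSubspace_subspace _ _,
      Spin.PolyhedralType.finrank_icosahedral_sixty⟩,
    ⟨36, by norm_num, Spin.PolyhedralType.isAnticoherentSubspace_subspace _ _,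
      Spin.PolyhedralType.finrank_icosahedral_seventy_two⟩,
    fun a b c => ⟨Spin.PolyhedralType.isAnticoherentSubspace_subspace _ _,
      Spin.PolyhedralType.two_le_finrank_icosahedral a b c⟩,
    Spin.PolyhedralType.exists_tetrahedral_basis⟩
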